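/- **Conventions.** For a positive integer $q$ let $u_{1,q}=q$ and $u_{k+1,q}=u_{k,q}(u_{k,q}+1)$ for $k\ge 1$. A *polytope* in $\mathbb{R}^d$ is a bounded intersection of finitely many closed affine half-spaces; $\operatorname{vert}(P)$ is its set of vertices and $\dim P$ the dimension of its affine span. A *simplex* is a polytope of some dimension $k$ with exactly $k+1$ vertices. Let $\varepsilon>0$. A $d$-dimensional *$\varepsilon$-lc Fano polytope* in $\mathbb{R}^d$ is a polytope $P$ whose vertices are primitive points of $\mathbb{Z}^d$, with $0\in\operatorname{int}(P)$ and $\operatorname{int}(\varepsilon P)\cap\mathbb{Z}^d=\{0\}$. It is *minimal* if for every $v\in\operatorname{vert}(P)$ the convex hull of $(P\cap\mathbb{Z}^d)\setminus\{v\}$ is not a $d$-dimensional $\varepsilon$-lc Fano polytope. A (possibly lower-dimensional) *$\varepsilon$-lc Fano simplex* in $\mathbb{R}^d$ is a simplex $S\subset\mathbb{R}^d$ whose vertices are primitive points of $\mathbb{Z}^d$, with $0$ in the relative interior of $S$, and such that $0$ is the only point of $\mathbb{Z}^d$ in the relative interior of $\varepsilon S$. The dual of $P$ is $P^*=\{m\in\mathbb{R}^d:\langle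 m,v\rangle+1\ge 0\ \text{for all } v\in P\}$, and $\operatorname{Vol}(K)=d!\cdot\operatorname{vol}(K)$ is the normalized volume on $\mathbb{R}^d$, where $\operatorname{vol}$ is Lebesgue measure. **Proposition 5.2.** Let $d\ge 3$ and $q\ge 2$ be integers, and let $P\subset\mathbb{R}^d$ be a $d$-dimensional minimal $\frac1q$-lc Fano polytope that is not a simplex. Let $P$ be decomposed as $P=\operatorname{conv}(S_1\cup\cdots\cup S_t)$ with $2\le t\le d$, where the $S_i$ are $\frac1q$-lc Fano simplices with $d_i:=\dim S_i<d$ and $\operatorname{vert}(S_i)\subset\operatorname{vert}(P)$ such that, with $r_i:=|\operatorname{vert}(S_i)\cap\operatorname{vert}(P_{i-1})|$, $P_0=\emptyset$ and $P_{i-1}:=\operatorname{conv}(S_1\cup\cdots\cup S_{i-1})$ for $i\ge 2$, $$d_1+\cdots+d_t=d+\sum_{i=1}^t r_i,\qquad r_i<d_i\le d-t+1\ \ (1\le i\le t),\qquad |\operatorname{vert}(P)|=d+t.$$ Suppose that it is not the case that $t=2$ and $d_1=d_2=d-1$. Then $$\operatorname{Vol}(P^*)<\frac{2u_{d,q}^2}{q^{d+1}}.$$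 -/

import Mathlib

open MeasureTheory
open scoped Pointwise ENNReal

namespace LcFano

/-- The sequence `u_{1,q} = q`, `u_{k+1,q} = u_{k,q} (u_{k,q} + 1)`.
The value at index `0` is a dummy; the sequence starts at index `1`. -/
def u (q : ℕ) : ℕ → ℕ
  | 0 => 0
  | 1 => q
  | k + 2 => u q (k + 1) * (u q (k + 1) + 1)

/-- The lattice `ℤ^d` inside `ℝ^d`. -/
def latticePoints (d : ℕ) : Set (Fin d → ℝ) :=
  {x | ∃ n : Fin d → ℤ, x = fun i => (n i : ℝ)}

/-- A primitive lattice point of `ℤ^d`: its coordinates are integers with greatest common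
divisor `1` (in particular it is nonzero). -/
def IsPrimitiveLatticePoint {d : ℕ} (x : Fin d → ℝ) : Prop :=
  ∃ n : Fin d → ℤ, (x = fun i => (n i : ℝ)) ∧ Finset.univ.gcd n = 1

/-- A polytope in `ℝ^d`: a bounded intersection of finitely many (closed) affine half-spaces
`{x | ⟨a, x⟩ ≤ b}` with `a ≠ 0`. Such a set is automatically convex. -/
def IsPolytope {d : ℕ} (P : Set (Fin d → ℝ)) : Prop :=
  Bornology.IsBounded P ∧
    ∃ H : Finset ((Fin d → ℝ) × ℝ), (∀ h ∈ H, h.1 ≠ 0) ∧ P = {x | ∀ h ∈ H, h.1 ⬝ᵥ x ≤ h.2}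

/-- The set of vertices of a polytope. -/
def vert {d : ℕ} (P : Set (Fin d → ℝ)) : Set (Fin d → ℝ) :=
  P.extremePoints ℝ

/-- The dimension of a polytope: the dimension of its affine span. -/
noncomputable def polyDim {d : ℕ} (P : Set (Fin d → ℝ)) : ℕ :=
  Module.finrank ℝ (vectorSpan ℝ P)

/-- A simplex, of any dimension `k ≤ d`, in `ℝ^d`: a `k`-dimensional polytope with exactly
`k + 1` vertices. -/
def IsSimplex {d : ℕ} (S : Set (Fin d → ℝ)) : Prop :=
  IsPolytope S ∧ (vert S).ncard = polyDim S + 1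

/-- A (full-dimensional) `ε`-lc Fano polytope in `ℝ^d`: a polytope whose vertices are primitive
lattice points, with the origin in its interior, and such that the origin is the only lattice
point in the interior of `ε P`. It is `d`-dimensional since its interior is nonempty. -/
structure IsLcFanoPolytope {d : ℕ} (ε : ℝ) (P : Set (Fin d → ℝ)) : Prop where
  isPolytope : IsPolytope P
  primitive : ∀ v ∈ vert P, IsPrimitiveLatticePoint v
  zero_mem : (0 : Fin d → ℝ) ∈ interior P
  lc : interior (ε • P) ∩ latticePoints d = {0}

/-- A minimal `ε`-lc Fano polytope: for no vertex `v` is the convex hull of the lattice points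
of `P` other than `v` again a `d`-dimensional `ε`-lc Fano polytope. -/
structure IsMinimalLcFanoPolytope {d : ℕ} (ε : ℝ) (P : Set (Fin d → ℝ)) : Prop where
  isLcFano : IsLcFanoPolytope ε P
  minimal : ∀ v ∈ vert P, ¬ IsLcFanoPolytope ε (convexHull ℝ ((P ∩ latticePoints d) \ {v}))

/-- An `ε`-lc Fano simplex of possibly lower dimension in `ℝ^d`, i.e. an `ε`-lc Fano polytope,
which is a simplex, in the linear span `V` of `S` with the lattice `V ∩ ℤ^d`. Interiors are taken
relative to the affine span of `S`, which is `V` because `0 ∈ S`; a point of `V ∩ ℤ^d` is primitive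
in `V ∩ ℤ^d` if and only if it is primitive in `ℤ^d`. -/
structure IsLcFanoSimplex {d : ℕ} (ε : ℝ) (S : Set (Fin d → ℝ)) : Prop where
  isSimplex : IsSimplex S
  primitive : ∀ v ∈ vert S, IsPrimitiveLatticePoint v
  zero_mem : (0 : Fin d → ℝ) ∈ intrinsicInterior ℝ S
  lc : intrinsicInterior ℝ (ε • S) ∩ latticePoints d = {0}

/-- The polytope `conv (S_j : j < i)` spanned by the members of the family before the `i`-th one
(the empty set for the first index). -/
def partialHull {d t : ℕ} (S : Fin t → Set (Fin d → ℝ)) (i : Fin t) : Set (Fin d → ℝ) :=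
  convexHull ℝ (⋃ j : Fin t, ⋃ _ : j < i, S j)

/-- The number `r_i` of vertices of `S_i` that are vertices of `conv (S_j : j < i)`. -/
noncomputable def sharedVertices {d t : ℕ} (S : Fin t → Set (Fin d → ℝ)) (i : Fin t) : ℕ :=
  (vert (S i) ∩ vert (partialHull S i)).ncard

/-- A decomposition of a `d`-dimensional polytope `P` into lower-dimensional `ε`-lc Fano simplices
`S_1, …, S_t`, with `2 ≤ t ≤ d`, `d_i = dim S_i` and `r_i` the number of vertices that `S_i` shares
with `conv (S_1 ∪ ⋯ ∪ S_{i-1})`. -/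
structure IsSimplexDecomposition {d t : ℕ} (ε : ℝ) (P : Set (Fin d → ℝ))
    (S : Fin t → Set (Fin d → ℝ)) : Prop where
  two_le : 2 ≤ t
  le_dim : t ≤ d
  isLcFanoSimplex : ∀ i, IsLcFanoSimplex ε (S i)
  dim_lt : ∀ i, polyDim (S i) < d
  hull_eq : P = convexHull ℝ (⋃ i, S i)
  vert_subset : ∀ i, vert (S i) ⊆ vert P
  /-- `d_1 + ⋯ + d_t = d + r_1 + ⋯ + r_t` -/
  sum_dim : ∑ i, polyDim (S i) = d + ∑ i, sharedVertices S i
  /-- `r_i < d_i` -/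
  shared_lt : ∀ i, sharedVertices S i < polyDim (S i)
  /-- `d_i ≤ d - t + 1` -/
  dim_le : ∀ i, polyDim (S i) + t ≤ d + 1
  /-- `P` has exactly `d + t` vertices -/
  card_vert : (vert P).ncard = d + t

/-- The dual `{m | ⟨m, v⟩ + 1 ≥ 0 for all v ∈ P}`. -/
def dual {d : ℕ} (P : Set (Fin d → ℝ)) : Set (Fin d → ℝ) :=
  {m | ∀ v ∈ P, 0 ≤ m ⬝ᵥ v + 1}

/-- The normalized volume `d! · vol`, with `vol` the Lebesgue measure on `ℝ^d`, as an extended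
nonnegative real number. -/
noncomputable def normalizedVolume {d : ℕ} (K : Set (Fin d → ℝ)) : ℝ≥0∞ :=
  (Nat.factorial d : ℝ≥0∞) * volume K

end LcFano

/-! Write `X i` for the vertices of `S i`, `β i` for the barycentric coordinates of the origin in `S
i`, and `n i = d_i - r_i`, so that the `n i` add up to `d`. In each simplex, omit from the `n i + 1`
unshared vertices one of smallest weight and call the rest `K i`. The `d` vectors in all the `K i`
form a basis: shared vertices lie in the span of earlier simplices, and the omitted vertex is
recovered from `∑ β v = 0`.

For `m` in the dual, the numbers `⟨m, v⟩ + 1` are nonnegative, and their `β i`-weighted sum over `X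
i` is exactly 1. The affine map recording them on all the `K i` therefore sends the dual into a
product of corner simplices. Its linear part is a nonsingular integer matrix, so it does not
decrease volume, and the dual has volume at most the product of the `1 / (n i ! ∏_{K i} β)`.

It remains to bound the weights below. If `∏_A β > q^|A| ∑_{X \ A} β` for a proper subset `A`,
Minkowski's theorem yields a nonzero lattice point in the relative interior of `(1/q) S`, which is
impossible (`prod_le_pow_mul_sum_sdiff`). Under these inequalities the extremal sequence is `q /
(u_k + 1)`, and comparison with it bounds the tail sums of the sorted weights (`div_u_le_sum_Ico`).
This gives a bound for the dual volume by products of `u_k` over the windows `r_i < k ≤ d_i`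
(`normalizedVolume_dual_le`). The growth of `u` absorbs the crude factor `d! 2^d` unless `t = 2` and
both dimensions are `d - 1` (`prod_windows_lt`). -/

namespace LcFano

/-! ### Growth of the sequence `u`. -/

theorem u_succ (q : ℕ) {k : ℕ} (hk : 1 ≤ k) : u q (k + 1) = u q k * (u q k + 1) := by
  obtain ⟨k, rfl⟩ := Nat.exists_eq_add_of_le' hk
  rfl

theorem u_pos {q : ℕ} (hq : 1 ≤ q) {k : ℕ} (hk : 1 ≤ k) : 1 ≤ u q k := by
  induction k, hk using Nat.le_induction with
  | base => exact hq
  | succ k hk ih =>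
    rw [u_succ q hk]
    exact Nat.mul_pos ih (Nat.succ_pos _)

theorem u_le_succ (q k : ℕ) : u q k ≤ u q (k + 1) := by
  rcases Nat.eq_zero_or_pos k with rfl | hk
  · exact Nat.zero_le _
  · rw [u_succ q hk]
    exact Nat.le_mul_of_pos_right _ (Nat.succ_pos _)

theorem u_mono (q : ℕ) : Monotone (u q) := monotone_nat_of_le_succ (u_le_succ q)

theorem mul_prod_u_add_one (q m : ℕ) :
    q * ∏ k ∈ Finset.range m, (u q (k + 1) + 1) = u q (m + 1) := by
  induction m with
  | zero => simp [u]
  | succ m ih =>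
    rw [Finset.prod_range_succ, ← mul_assoc, ih, ← u_succ q (Nat.le_add_left 1 m)]

/-- This collapses a whole initial window into a single next term and still gains a factor `q + 1`,
which later pays for factorials. -/
theorem mul_prod_u_le (q : ℕ) {m : ℕ} (hm : 1 ≤ m) :
    (q + 1) * ∏ k ∈ Finset.Ioc 0 m, u q k ≤ u q (m + 1) := by
  induction m, hm using Nat.le_induction with
  | base => simp [u, mul_comm]
  | succ m hm ih =>
    rw [← Finset.insert_Ioc_right_eq_Ioc_add_one (Nat.zero_le m), Finset.prod_insert (by simp),
      u_succ q (by omega : 1 ≤ m + 1)]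
    calc (q + 1) * (u q (m + 1) * ∏ k ∈ Finset.Ioc 0 m, u q k)
        = u q (m + 1) * ((q + 1) * ∏ k ∈ Finset.Ioc 0 m, u q k) := by ring
      _ ≤ u q (m + 1) * (u q (m + 1) + 1) := by gcongr; omega

theorem prod_u_Ioc_le_of_subset {q : ℕ} (hq : 1 ≤ q) {a b m : ℕ} (hb : b ≤ m) :
    ∏ k ∈ Finset.Ioc a b, u q k ≤ ∏ k ∈ Finset.Ioc 0 m, u q k :=
  Finset.prod_le_prod_of_subset_of_one_le' (Finset.Ioc_subset_Ioc (Nat.zero_le a) hb)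
    fun k hk _ => u_pos hq (by simp at hk; omega)

theorem prod_u_Ioc_shift_le (q : ℕ) {a b n : ℕ} (hab : a ≤ b) :
    ∏ k ∈ Finset.Ioc a (a + n), u q k ≤ ∏ k ∈ Finset.Ioc b (b + n), u q k := by
  induction n with
  | zero => simp
  | succ n ih =>
    rw [← add_assoc, ← add_assoc, ← Finset.insert_Ioc_right_eq_Ioc_add_one (by omega),
      ← Finset.insert_Ioc_right_eq_Ioc_add_one (by omega), Finset.prod_insert (by simp),
      Finset.prod_insert (by simp)]
    exact Nat.mul_le_mul (u_mono q (by omega)) ih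

theorem factorial_mul_two_pow_le {q d : ℕ} (hq : 2 ≤ q) (hd : 3 ≤ d) :
    d.factorial * 2 ^ (d - 1) * q ≤ (q + 1) ^ 3 * u q (d - 1) := by
  have h4 : ∀ e, 3 ≤ e → (e + 1).factorial * 2 ^ e * q ≤ (q + 1) ^ 3 * u q e ∧ 2 * e + 4 ≤ u q e := by
    intro e he
    induction e, he using Nat.le_induction with
    | base =>
      simp only [u, Nat.factorial]
      constructor <;> nlinarith [Nat.mul_le_mul hq hq, Nat.mul_le_mul (Nat.mul_le_mul hq hq) hq,
        Nat.mul_le_mul (Nat.mul_le_mul hq hq) (Nat.mul_le_mul hq hq)]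
    | succ e he ih =>
      rw [u_succ q (by omega)]
      refine ⟨?_, by nlinarith [ih.2]⟩
      rw [Nat.factorial_succ (e + 1), pow_succ]
      calc (e + 1 + 1) * (e + 1).factorial * (2 ^ e * 2) * q
          = (2 * e + 4) * ((e + 1).factorial * 2 ^ e * q) := by ring
        _ ≤ (u q e + 1) * ((q + 1) ^ 3 * u q e) := Nat.mul_le_mul (by omega) ih.1
        _ = _ := by ring
  -- The induction starts at `e = 3`, since its growth condition `2 * e + 4 ≤ u q e` fails at `e =
  -- 2` for `q = 2`; hence `d = 3` is done by hand.
  rcases hd.eq_or_lt with rfl | hd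
  · calc Nat.factorial 3 * 2 ^ (3 - 1) * q = 24 * q := by simp [Nat.factorial]
      _ ≤ 3 ^ 4 * q := by gcongr; norm_num
      _ ≤ (q + 1) ^ 4 * q := by gcongr; omega
      _ = (q + 1) ^ 3 * (q * (q + 1)) := by ring
  · obtain ⟨e, rfl⟩ := Nat.exists_eq_add_of_le' (by omega : 1 ≤ d)
    exact (h4 e (by omega)).1

theorem factorial_mul_two_pow_mul_u_lt {q d : ℕ} (hq : 2 ≤ q) (hd : 3 ≤ d) :
    d.factorial * 2 ^ (d - 1) * q * u q (d - 2) < (q + 1) * u q d := by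
  obtain ⟨e, rfl⟩ := Nat.exists_eq_add_of_le' (by omega : 2 ≤ d)
  simp only [Nat.add_sub_cancel]
  have h0 : 1 ≤ u q e := u_pos (by omega) (by omega)
  rcases hd.eq_or_lt with h | hd
  · obtain rfl : e = 1 := by omega
    calc Nat.factorial 3 * 2 ^ 2 * q * q = 24 * q * q := by simp [Nat.factorial]
      _ < 3 ^ 2 * (2 * q + q + 1) * q := by nlinarith
      _ ≤ (q + 1) ^ 2 * (q * q + q + 1) * q := by gcongr; omega
      _ = (q + 1) * (q * (q + 1) * (q * (q + 1) + 1)) := by ring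
  -- With `d = e + 2`, the term `u q d` factors as `u_e (u_e + 1) (u_{e+1} + 1)`, so `u_e` cancels
  -- and this remains. The condition `2 * e + 2 ≤ u q e` drives the induction; it is tight at `e = q
  -- = 2`.
  have h1 : ∀ e, 2 ≤ e → (e + 2).factorial * 2 ^ (e + 1) * q <
      (q + 1) * ((u q e + 1) * (u q (e + 1) + 1)) ∧ 2 * e + 2 ≤ u q e := by
    intro e he
    induction e, he using Nat.le_induction with
    | base =>
      simp only [u]
      refine ⟨?_, by nlinarith⟩
      calc Nat.factorial 4 * 2 ^ 3 * q = 192 * q := by simp [Nat.factorial]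
        _ < (q + 1) * ((2 * (2 + 1) + 1) * (2 * (2 + 1) * (2 * (2 + 1) + 1) + 1)) := by omega
        _ ≤ (q + 1) * ((q * (q + 1) + 1) * (q * (q + 1) * (q * (q + 1) + 1) + 1)) := by gcongr
    | succ e he ih =>
      have h3 := u_succ q (by omega : 1 ≤ e)
      have h5 := u_succ q (by omega : 1 ≤ e + 1)
      refine ⟨?_, by rw [h3]; nlinarith [ih.2]⟩
      have h6 : 2 * e + 6 ≤ u q (e + 1) := by rw [h3]; nlinarith [ih.2]
      rw [show e + 1 + 2 = e + 2 + 1 by ring, Nat.factorial_succ (e + 2), pow_succ _ (e + 1)]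
      calc (e + 2 + 1) * (e + 2).factorial * (2 ^ (e + 1) * 2) * q
          = (2 * e + 6) * ((e + 2).factorial * 2 ^ (e + 1) * q) := by ring
        _ < (2 * e + 6) * ((q + 1) * ((u q e + 1) * (u q (e + 1) + 1))) :=
            Nat.mul_lt_mul_of_pos_left ih.1 (by omega)
        _ = (q + 1) * ((u q (e + 1) + 1) * ((2 * e + 6) * (u q e + 1))) := by ring
        _ ≤ (q + 1) * ((u q (e + 1) + 1) * (u q (e + 1 + 1) + 1)) := by
            gcongr
            rw [h5]
            have : u q e + 1 ≤ u q (e + 1) + 1 := by have := u_le_succ q e; omega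
            nlinarith [ih.2]
  rw [show e + 2 = e + 1 + 1 by ring, u_succ q (by omega : 1 ≤ e + 1)]
  have h2 := u_succ q (by omega : 1 ≤ e)
  calc (e + 1 + 1).factorial * 2 ^ (e + 1 + 1 - 1) * q * u q e
      < (q + 1) * ((u q e + 1) * (u q (e + 1) + 1)) * u q e :=
        Nat.mul_lt_mul_of_pos_right (h1 e (by omega)).1 h0
    _ = (q + 1) * (u q e * (u q e + 1) * (u q (e + 1) + 1)) := by ring
    _ = _ := by rw [← h2]

/-- Lowering the index of the sequence by `j` outweighs raising the exponent from `3` to `j + 3`. -/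
theorem pow_div_le_pow_div {q : ℕ} (hq : 1 ≤ q) (m j : ℕ) (hm : 2 ≤ m) :
    ((u q m : ℝ) / (q + 1)) ^ (j + 3) ≤ ((u q (m + j) : ℝ) / (q + 1)) ^ 3 := by
  induction j generalizing m with
  | zero => simp
  | succ j ih =>
    have hq1 : (0 : ℝ) < q + 1 := by positivity
    have hqr : (1 : ℝ) ≤ q := by exact_mod_cast hq
    have h1 : (1 : ℝ) ≤ (u q m : ℝ) / (q + 1) := by
      rw [le_div_iff₀ hq1, one_mul]
      have : u q 2 ≤ u q m := u_mono q hm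
      have h2 : u q 2 = q * (q + 1) := rfl
      have : q + 1 ≤ u q m := by nlinarith
      exact_mod_cast this
    -- After division by `q + 1` the sequence still at least squares at each step, while the
    -- exponent drops only from `j + 4` to `j + 3`.
    have h2 : ((u q m : ℝ) / (q + 1)) ^ 2 ≤ (u q (m + 1) : ℝ) / (q + 1) := by
      rw [u_succ q (by omega), div_pow, div_le_div_iff₀ (by positivity) hq1]
      push_cast
      have : (0 : ℝ) ≤ u q m := by positivity
      nlinarith [mul_nonneg this this, mul_nonneg (mul_nonneg this this) hq1.le,
        mul_nonneg (mul_nonneg this this) (sq_nonneg ((q : ℝ) + 1)), mul_nonneg this (sq_nonneg ((q : ℝ) + 1)),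
        mul_nonneg (mul_nonneg (mul_nonneg this this) hq1.le) (by linarith : (0:ℝ) ≤ q)]
    calc ((u q m : ℝ) / (q + 1)) ^ (j + 1 + 3) ≤ ((u q m : ℝ) / (q + 1)) ^ (2 * (j + 3)) :=
          pow_le_pow_right₀ h1 (by omega)
      _ = (((u q m : ℝ) / (q + 1)) ^ 2) ^ (j + 3) := by rw [pow_mul]
      _ ≤ ((u q (m + 1) : ℝ) / (q + 1)) ^ (j + 3) := by gcongr
      _ ≤ _ := ih (m + 1) (by omega)
      _ = _ := by rw [show m + 1 + j = m + (j + 1) by ring]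

/-! ### Products of `u` over windows of indices. -/

theorem prod_windows_two_le {q d a n D : ℕ} (ha : 1 ≤ a) (hn : 1 ≤ n)
    (han : a + n = d) (hnD : n ≤ D) (hD : D ≤ d - 1) (hexc : ¬ (a = d - 1 ∧ D = d - 1)) :
    (∏ k ∈ Finset.Ioc 0 a, u q k) * ∏ k ∈ Finset.Ioc (D - n) D, u q k ≤
      (∏ k ∈ Finset.Ioc 0 (d - 1), u q k) * u q (d - 2) := by
  -- If `a = d - 1`, the second window is one index, at most `d - 2` by `hexc`. Otherwise detach
  -- `u_a ≤ u_{d-2}` from the first window and slide the second one up to end at `d - 1`, so that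
  -- together they fill `1, …, d - 1`.
  by_cases h : a = d - 1
  · obtain rfl : n = 1 := by omega
    rw [h]
    gcongr
    obtain ⟨D, rfl⟩ := Nat.exists_eq_add_of_le' hnD
    simpa using u_mono q (by omega : D + 1 ≤ d - 2)
  · obtain ⟨b, rfl⟩ := Nat.exists_eq_add_of_le' hnD
    obtain ⟨c, rfl⟩ := Nat.exists_eq_add_of_le' ha
    have h1 := prod_u_Ioc_shift_le q (n := n) (show b ≤ c by omega)
    have h2 : ∏ k ∈ Finset.Ioc 0 (d - 1), u q k =
        (∏ k ∈ Finset.Ioc 0 c, u q k) * ∏ k ∈ Finset.Ioc c (c + n), u q k := by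
      rw [show d - 1 = c + n by omega,
        Finset.prod_Ioc_consecutive _ (Nat.zero_le c) (Nat.le_add_right c n)]
    rw [h2, ← Finset.insert_Ioc_right_eq_Ioc_add_one (Nat.zero_le c), Finset.prod_insert (by simp),
      Nat.add_sub_cancel]
    have h3 := u_mono q (by omega : c + 1 ≤ d - 2)
    calc _ ≤ u q (d - 2) * (∏ k ∈ Finset.Ioc 0 c, u q k) * ∏ k ∈ Finset.Ioc c (c + n), u q k := by
          gcongr
      _ = _ := by ring

/-- For `t = 2` the bound on pairs of windows leaves one spare factor `u_{d-2}`, small against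
`u_d`. For `t ≥ 3` all windows lie below `d + 2 - t`, and the product is so small that `u_{d-1}^4 <
u_d^2` suffices. -/
theorem prod_windows_lt {q d t : ℕ} (hq : 2 ≤ q) (hd : 3 ≤ d) (ht : 2 ≤ t) (htd : t ≤ d)
    (n D : Fin t → ℕ) (hn : ∀ i, 1 ≤ n i) (hnD : ∀ i, n i ≤ D i) (hsum : ∑ i, n i = d)
    (hD : ∀ i, D i + t ≤ d + 1) (h0 : ∀ i : Fin t, (i : ℕ) = 0 → n i = D i)
    (hexc : ¬ (t = 2 ∧ ∀ i, D i = d - 1)) :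
    d.factorial * 2 ^ d * q * ∏ i, ∏ k ∈ Finset.Ioc (D i - n i) (D i), u q k < 2 * u q d ^ 2 := by
  have hd2 : 2 ^ d = 2 * 2 ^ (d - 1) := by
    rw [← pow_succ']; congr 1; omega
  have hud : 1 ≤ u q d := u_pos (by omega) (by omega)
  have hud' : 1 ≤ u q (d - 1) := u_pos (by omega) (by omega)
  rw [hd2]
  rcases ht.eq_or_lt with rfl | ht
  · rw [Fin.sum_univ_two] at hsum
    rw [Fin.prod_univ_two]
    have h00 := h0 0 rfl
    have hn0 := hn 0
    have hn1 := hn 1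
    have hD0 := hD 0
    have hD1 := hD 1
    rw [← h00, Nat.sub_self]
    have h1 := prod_windows_two_le (q := q) hn0 hn1 hsum (hnD 1) (by omega) (by
      rintro ⟨h, h'⟩
      refine hexc ⟨rfl, fun i => ?_⟩
      fin_cases i
      · exact h00.symm.trans h
      · exact h')
    have h2 := mul_prod_u_le q (m := d - 1) (by omega)
    rw [show d - 1 + 1 = d by omega] at h2
    have h3 := factorial_mul_two_pow_mul_u_lt hq hd
    set X := (∏ k ∈ Finset.Ioc 0 (n 0), u q k) * ∏ k ∈ Finset.Ioc (D 1 - n 1) (D 1), u q k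
    set Y := ∏ k ∈ Finset.Ioc 0 (d - 1), u q k
    refine lt_of_mul_lt_mul_left (a := q + 1) ?_ (Nat.zero_le _)
    calc (q + 1) * (d.factorial * (2 * 2 ^ (d - 1)) * q * X)
        ≤ (q + 1) * (d.factorial * (2 * 2 ^ (d - 1)) * q * (Y * u q (d - 2))) := by gcongr
      _ = 2 * (d.factorial * 2 ^ (d - 1) * q * u q (d - 2)) * ((q + 1) * Y) := by ring
      _ ≤ 2 * (d.factorial * 2 ^ (d - 1) * q * u q (d - 2)) * u q d := by gcongr
      _ < 2 * ((q + 1) * u q d) * u q d := by gcongr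
      _ = _ := by ring
  · have h1 : (q + 1) ^ t * ∏ i, ∏ k ∈ Finset.Ioc (D i - n i) (D i), u q k ≤
        u q (d + 2 - t) ^ t := by
      calc (q + 1) ^ t * ∏ i, ∏ k ∈ Finset.Ioc (D i - n i) (D i), u q k
          = ∏ i, ((q + 1) * ∏ k ∈ Finset.Ioc (D i - n i) (D i), u q k) := by
            rw [Finset.prod_mul_distrib]; simp
        _ ≤ ∏ i : Fin t, u q (d + 2 - t) := by
            refine Finset.prod_le_prod' fun i _ => ?_
            have := hD i
            calc (q + 1) * ∏ k ∈ Finset.Ioc (D i - n i) (D i), u q k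
                ≤ (q + 1) * ∏ k ∈ Finset.Ioc 0 (d + 1 - t), u q k := by
                  exact Nat.mul_le_mul_left _ (prod_u_Ioc_le_of_subset (by omega) (by omega))
              _ ≤ u q (d + 1 - t + 1) := mul_prod_u_le q (by omega)
              _ = _ := by rw [show d + 1 - t + 1 = d + 2 - t by omega]
        _ = _ := by simp
    obtain ⟨j, rfl⟩ := Nat.exists_eq_add_of_le' (show 3 ≤ t from ht)
    set X := ∏ i, ∏ k ∈ Finset.Ioc (D i - n i) (D i), u q k
    -- Here `t = j + 3`: many factors of low index are traded for three factors of index `d - 1`.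
    have h2 := pow_div_le_pow_div (q := q) (by omega) (d + 2 - (j + 3)) j (by omega)
    rw [show d + 2 - (j + 3) + j = d - 1 by omega] at h2
    have h3 : (X : ℝ) ≤ ((u q (d - 1) : ℝ) / (q + 1)) ^ 3 := by
      refine le_trans ?_ h2
      rw [div_pow, le_div_iff₀ (by positivity), mul_comm]
      exact_mod_cast h1
    have h4 : (q + 1) ^ 3 * X ≤ u q (d - 1) ^ 3 := by
      rw [div_pow, le_div_iff₀ (by positivity), mul_comm] at h3
      exact_mod_cast h3
    have h5 := factorial_mul_two_pow_le hq hd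
    have h6 : d.factorial * 2 ^ (d - 1) * q * X ≤ u q (d - 1) ^ 4 := by
      refine le_of_mul_le_mul_left (a := (q + 1) ^ 3) ?_ (by positivity)
      calc (q + 1) ^ 3 * (d.factorial * 2 ^ (d - 1) * q * X)
          = d.factorial * 2 ^ (d - 1) * q * ((q + 1) ^ 3 * X) := by ring
        _ ≤ (q + 1) ^ 3 * u q (d - 1) * u q (d - 1) ^ 3 := Nat.mul_le_mul h5 h4
        _ = _ := by ring
    have h7 : u q d = u q (d - 1) * (u q (d - 1) + 1) := by
      rw [← u_succ q (by omega), show d - 1 + 1 = d by omega]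
    rw [h7]
    nlinarith [Nat.mul_le_mul hud' hud', Nat.pow_le_pow_left hud' 3]

/-! ### Weights subject to product-sum inequalities. -/

theorem sum_div_u_add_one {q : ℕ} (hq : 1 ≤ q) (k : ℕ) :
    ∑ i ∈ Finset.range k, (q : ℝ) / (u q (i + 1) + 1) = 1 - q / u q (k + 1) := by
  induction k with
  | zero =>
    have : (q : ℝ) ≠ 0 := by positivity
    simp [u, this]
  | succ k ih =>
    have h : (0 : ℝ) < u q (k + 1) := by exact_mod_cast u_pos hq (by omega : 1 ≤ k + 1)
    rw [Finset.sum_range_succ, ih, u_succ q (by omega : 1 ≤ k + 1)]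
    push_cast
    field_simp
    ring

/-- Together with the sum formula, this shows that `q / (u_k + 1)` attains equality in every
product-sum inequality when the total weight is 1. -/
theorem prod_div_u_add_one {q : ℕ} (hq : 1 ≤ q) (k : ℕ) :
    ∏ i ∈ Finset.range k, (q : ℝ) / (u q (i + 1) + 1) = q ^ k * (q / u q (k + 1)) := by
  rw [Finset.prod_div_distrib, Finset.prod_const, Finset.card_range, ← mul_prod_u_add_one q k]
  push_cast
  have : (q : ℝ) ≠ 0 := by positivity
  have : ∏ i ∈ Finset.range k, ((u q (i + 1) : ℝ) + 1) ≠ 0 :=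
    Finset.prod_ne_zero_iff.2 fun i _ => by positivity
  field_simp

/-- Abel summation: moving to the larger weight `w (k + 1)` can only lower the contribution of a
nonpositive partial sum. -/
theorem mul_sum_le_sum_mul_of_partial_sums_nonpos {c w : ℕ → ℝ} (k : ℕ)
    (hw : ∀ i < k, w i ≤ w (i + 1))
    (hs : ∀ j ≤ k, ∑ i ∈ Finset.range j, c i ≤ 0) :
    (∑ i ∈ Finset.range (k + 1), c i) * w k ≤ ∑ i ∈ Finset.range (k + 1), c i * w i := by
  induction k with
  | zero => simp
  | succ k ih =>
    have h1 := ih (fun i hi => hw i (by omega)) (fun j hj => hs j (by omega))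
    have h2 := hs (k + 1) le_rfl
    have h3 := hw k (by omega)
    rw [Finset.sum_range_succ _ (k + 1), Finset.sum_range_succ _ (k + 1)]
    nlinarith

/-- If a nonincreasing sequence has smaller partial sums than `a`, but a larger total, then it has
the larger product. -/
theorem prod_lt_prod_of_partial_sums {a b : ℕ → ℝ} (k : ℕ) (ha : ∀ i < k, 0 < a i)
    (hb : ∀ i < k, 0 < b i) (hanti : ∀ i, i + 1 < k → b (i + 1) ≤ b i)
    (hs : ∀ j < k, ∑ i ∈ Finset.range j, b i ≤ ∑ i ∈ Finset.range j, a i)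
    (hk : ∑ i ∈ Finset.range k, a i < ∑ i ∈ Finset.range k, b i) :
    ∏ i ∈ Finset.range k, a i < ∏ i ∈ Finset.range k, b i := by
  obtain _ | k := k
  · simp at hk
  have h1 := mul_sum_le_sum_mul_of_partial_sums_nonpos (c := fun i => b i - a i)
    (w := fun i => (b i)⁻¹) k
    (fun i hi => inv_anti₀ (hb _ (by omega)) (hanti i (by omega)))
    (fun j hj => by
      rw [Finset.sum_sub_distrib]
      linarith [hs j (by omega)])
  -- The weights `1 / b i` are nondecreasing, so Abel summation turns the hypotheses on sums into
  -- positivity of the sum of the relative differences.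
  have h2 : 0 < ∑ i ∈ Finset.range (k + 1), (b i - a i) * (b i)⁻¹ := by
    refine lt_of_lt_of_le (mul_pos ?_ (inv_pos.2 (hb k (by omega)))) h1
    rw [Finset.sum_sub_distrib]
    linarith
  -- Each ratio is `1 - (b - a) / b`, at most `exp (-(b - a) / b)`.
  have h3 : ∏ i ∈ Finset.range (k + 1), a i / b i < 1 := by
    calc ∏ i ∈ Finset.range (k + 1), a i / b i
        ≤ ∏ i ∈ Finset.range (k + 1), Real.exp (-((b i - a i) * (b i)⁻¹)) := by
          refine Finset.prod_le_prod (fun i hi => ?_) (fun i hi => ?_)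
          · have hi := Finset.mem_range.1 hi
            exact (div_pos (ha i hi) (hb i hi)).le
          · have hi := hb i (Finset.mem_range.1 hi)
            have := Real.add_one_le_exp (-((b i - a i) * (b i)⁻¹))
            refine le_trans (le_of_eq ?_) this
            field_simp
            ring
      _ = Real.exp (-∑ i ∈ Finset.range (k + 1), (b i - a i) * (b i)⁻¹) := by
          rw [← Real.exp_sum, Finset.sum_neg_distrib]
      _ < 1 := by
          rw [Real.exp_lt_one_iff]
          linarith
  rw [Finset.prod_div_distrib, div_lt_one] at h3
  · exact h3
  · exact Finset.prod_pos fun i hi => hb i (Finset.mem_range.1 hi)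

/-- Sharp lower bound for the tails of a nonincreasing sequence subject to product-sum
inequalities. -/
theorem div_u_le_sum_Ico {q : ℕ} (hq : 1 ≤ q) {D : ℕ} {b : ℕ → ℝ} (hb : ∀ i ≤ D, 0 < b i)
    (hanti : ∀ i < D, b (i + 1) ≤ b i) (hsum : ∑ i ∈ Finset.range (D + 1), b i = 1)
    (hps : ∀ k ≤ D, ∏ i ∈ Finset.range k, b i ≤ q ^ k * ∑ i ∈ Finset.Ico k (D + 1), b i)
    {k : ℕ} (hk : k ≤ D) :
    (q : ℝ) / u q (k + 1) ≤ ∑ i ∈ Finset.Ico k (D + 1), b i := by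
  induction k using Nat.strong_induction_on with
  | _ k ih =>
    -- If the tail at `k` is too small while all earlier ones are not, the first `k` terms of `b`
    -- have a larger product than the extremal sequence, namely more than `q^k * (q / u_{k+1})`.
    -- This contradicts the product-sum inequality at `k`.
    by_contra! hlt
    have hsplit : ∀ j ≤ D, ∑ i ∈ Finset.range j, b i =
        1 - ∑ i ∈ Finset.Ico j (D + 1), b i := fun j hj => by
      rw [← hsum, ← Finset.sum_range_add_sum_Ico _ (by omega : j ≤ D + 1)]
      ring
    have h1 := prod_lt_prod_of_partial_sums (a := fun i => (q : ℝ) / (u q (i + 1) + 1)) (b := b) k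
      (fun i _ => by positivity) (fun i hi => hb i (by omega)) (fun i hi => hanti i (by omega))
      (fun j hj => by
        rw [sum_div_u_add_one hq, hsplit j (by omega)]
        linarith [ih j hj (by omega)])
      (by
        rw [sum_div_u_add_one hq, hsplit k hk]
        linarith)
    rw [prod_div_u_add_one hq] at h1
    have h2 := hps k hk
    have h3 : (0 : ℝ) < q ^ k := by positivity
    nlinarith

/-- The tail starting at `k` has `D + 1 - k` terms, of which `b k` is the largest. -/
theorem div_u_le_apply {q : ℕ} (hq : 1 ≤ q) {D : ℕ} {b : ℕ → ℝ} (hb : ∀ i ≤ D, 0 < b i)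
    (hanti : ∀ i < D, b (i + 1) ≤ b i) (hsum : ∑ i ∈ Finset.range (D + 1), b i = 1)
    (hps : ∀ k ≤ D, ∏ i ∈ Finset.range k, b i ≤ q ^ k * ∑ i ∈ Finset.Ico k (D + 1), b i)
    {k : ℕ} (hk : k ≤ D) :
    (q : ℝ) ≤ ((D + 1 - k : ℕ) * u q (k + 1) : ℕ) * b k := by
  have h1 := div_u_le_sum_Ico hq hb hanti hsum hps hk
  have h2 : ∀ j, k ≤ j → j ≤ D → b j ≤ b k := by
    intro j hj
    induction j, hj using Nat.le_induction with
    | base => exact fun _ => le_rfl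
    | succ j hj ih => exact fun h => (hanti j (by omega)).trans (ih (by omega))
  have h3 : ∑ i ∈ Finset.Ico k (D + 1), b i ≤ (D + 1 - k : ℕ) * b k := by
    calc ∑ i ∈ Finset.Ico k (D + 1), b i ≤ ∑ i ∈ Finset.Ico k (D + 1), b k :=
          Finset.sum_le_sum fun i hi => by
            rw [Finset.mem_Ico] at hi
            exact h2 i hi.1 (by omega)
      _ = _ := by simp
  have hu : (0 : ℝ) < u q (k + 1) := by exact_mod_cast u_pos hq (by omega : 1 ≤ k + 1)
  rw [div_le_iff₀ hu] at h1
  push_cast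
  nlinarith

/-- A finite set can be enumerated with nonincreasing values of a given function. -/
theorem exists_antitone_enumeration {α : Type*} [Nonempty α] [DecidableEq α] (β : α → ℝ)
    (X : Finset α) :
    ∃ e : ℕ → α, Set.InjOn e (Finset.range X.card) ∧ (Finset.range X.card).image e = X ∧
      ∀ i j, i ≤ j → j < X.card → β (e j) ≤ β (e i) := by
  induction h : X.card generalizing X with
  | zero =>
    obtain rfl := Finset.card_eq_zero.1 h
    exact ⟨fun _ => Classical.arbitrary α, by simp, by simp, by simp⟩
  | succ n ih =>
    obtain ⟨m, hm, hmin⟩ := X.exists_min_image β (Finset.card_pos.1 (by omega))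
    have hcard : (X.erase m).card = n := by rw [Finset.card_erase_of_mem hm]; omega
    obtain ⟨e, he, hi, ha⟩ := ih (X.erase m) hcard
    have hmem : ∀ i < n, e i ∈ X.erase m := fun i hi' => by
      rw [← hi]
      exact Finset.mem_image_of_mem _ (Finset.mem_range.2 hi')
    have hne : ∀ i < n, Function.update e n m i = e i := fun i hi' =>
      Function.update_of_ne (by omega) _ _
    refine ⟨Function.update e n m, ?_, ?_, ?_⟩
    · intro i hi' j hj hij
      simp only [Finset.coe_range, Set.mem_Iio] at hi' hj
      rcases Nat.lt_succ_iff_lt_or_eq.1 hi' with h1 | rfl <;>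
      rcases Nat.lt_succ_iff_lt_or_eq.1 hj with h2 | rfl
      · rw [hne i h1, hne j h2] at hij
        exact he (by simpa using h1) (by simpa using h2) hij
      · rw [hne i h1, Function.update_self] at hij
        exact absurd hij (Finset.mem_erase.1 (hmem i h1)).1
      · rw [hne j h2, Function.update_self] at hij
        exact absurd hij.symm (Finset.mem_erase.1 (hmem j h2)).1
      · rfl
    · rw [Finset.range_add_one, Finset.image_insert, Function.update_self,
        Finset.image_congr (g := e) (fun i hi' => hne i (by simpa using hi')), hi,
        Finset.insert_erase hm]
    · intro i j hij hj
      rcases Nat.lt_succ_iff_lt_or_eq.1 hj with h2 | rfl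
      · rw [hne j h2, hne i (by omega)]
        exact ha i j hij h2
      · rw [Function.update_self]
        rcases hij.eq_or_lt with rfl | h1
        · rw [Function.update_self]
        · rw [hne i h1]
          exact hmin _ (Finset.mem_of_mem_erase (hmem i h1))

/-- Product bound for all but one element of a subset `J` of a weight system subject to
product-sum inequalities. -/
theorem exists_pow_le_mul_prod_erase {α : Type*} [DecidableEq α] {q : ℕ} (hq : 1 ≤ q) {X J : Finset α}
    {β : α → ℝ} (hβ : ∀ x ∈ X, 0 < β x) (hsum : ∑ x ∈ X, β x = 1)
    (hps : ∀ A ⊂ X, ∏ x ∈ A, β x ≤ q ^ A.card * ∑ x ∈ X \ A, β x) (hJ : J ⊆ X)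
    {n r : ℕ} (hJn : J.card = n + 1) (hXr : X.card = r + n + 1) :
    ∃ w ∈ J, (q : ℝ) ^ n ≤
      ((n + 1).factorial * ∏ k ∈ Finset.Ioc r (r + n), u q k : ℕ) * ∏ x ∈ J.erase w, β x := by
  have : Nonempty α := ⟨(Finset.card_pos.1 (by omega : 0 < J.card)).choose⟩
  obtain ⟨e, he, hi, ha⟩ := exists_antitone_enumeration β X
  obtain ⟨f, hf, hfi, hfa⟩ := exists_antitone_enumeration β J
  rw [hXr] at he hi ha
  rw [hJn] at hf hfi hfa
  have heX : ∀ i < r + n + 1, e i ∈ X := fun i hi' => by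
    rw [← hi]
    exact Finset.mem_image_of_mem _ (Finset.mem_range.2 hi')
  have hfJ : ∀ i < n + 1, f i ∈ J := fun i hi' => by
    rw [← hfi]
    exact Finset.mem_image_of_mem _ (Finset.mem_range.2 hi')
  have hsum' : ∑ i ∈ Finset.range (r + n + 1), β (e i) = 1 := by
    rw [← hsum, ← hi, Finset.sum_image he]
  have hps' : ∀ k ≤ r + n, ∏ i ∈ Finset.range k, β (e i) ≤
      q ^ k * ∑ i ∈ Finset.Ico k (r + n + 1), β (e i) := by
    intro k hk
    have hsub : Finset.range k ⊆ Finset.range (r + n + 1) := Finset.range_subset_range.2 (by omega)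
    have hinj : Set.InjOn e (Finset.range k) := he.mono (by exact_mod_cast hsub)
    have hcard : ((Finset.range k).image e).card = k := by
      rw [Finset.card_image_of_injOn hinj, Finset.card_range]
    have hsub' : (Finset.range k).image e ⊆ X := hi ▸ Finset.image_subset_image hsub
    have h1 := hps ((Finset.range k).image e) (hsub'.ssubset_of_ne fun h => by
      rw [h, hXr] at hcard
      omega)
    have h2 := Finset.sum_sdiff (f := β) hsub'
    rw [hcard, Finset.prod_image hinj] at h1
    rw [Finset.sum_image hinj, hsum, ← hsum',
      ← Finset.sum_range_add_sum_Ico _ (by omega : k ≤ r + n + 1)] at h2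
    refine h1.trans (le_of_eq ?_)
    congr 1
    linarith
  have hlow : ∀ k ≤ r + n, (q : ℝ) ≤ ((r + n + 1 - k : ℕ) * u q (k + 1) : ℕ) * β (e k) :=
    fun k hk => div_u_le_apply (b := fun i => β (e i)) hq (fun i hi' => hβ _ (heX i (by omega)))
      (fun i hi' => ha i (i + 1) (by omega) (by omega)) hsum' hps' hk
  -- `J` misses only `r` elements of `X`. Were this false, the `n + 1 - j` smallest elements of `J`
  -- would all lie among the `n - j` smallest of `X`.
  have hcomp : ∀ j < n, β (e (r + j)) ≤ β (f j) := by
    intro j hj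
    by_contra! hlt
    have hsub : (Finset.Ico j (n + 1)).image f ⊆ (Finset.Ico (r + j + 1) (r + n + 1)).image e := by
      intro x hx
      obtain ⟨i, hi', rfl⟩ := Finset.mem_image.1 hx
      rw [Finset.mem_Ico] at hi'
      have h1 : f i ∈ X := hJ (hfJ i hi'.2)
      rw [← hi] at h1
      obtain ⟨p, hp, hpi⟩ := Finset.mem_image.1 h1
      refine Finset.mem_image.2 ⟨p, ?_, hpi⟩
      rw [Finset.mem_range] at hp
      rw [Finset.mem_Ico]
      refine ⟨?_, hp⟩
      by_contra! h2
      have h3 := ha p (r + j) (by omega) (by omega)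
      have h4 := hfa j i hi'.1 hi'.2
      rw [hpi] at h3
      linarith
    have h1 := Finset.card_le_card hsub
    rw [Finset.card_image_of_injOn (hf.mono fun i hi' => by simp at hi' ⊢; omega)] at h1
    have h2 := h1.trans Finset.card_image_le
    simp only [Nat.card_Ico] at h2
    omega
  refine ⟨f n, hfJ n (by omega), ?_⟩
  have herase : J.erase (f n) = (Finset.range n).image f := by
    rw [← hfi, Finset.range_add_one, Finset.image_insert, Finset.erase_insert]
    intro h
    obtain ⟨i, hi', hin⟩ := Finset.mem_image.1 h
    rw [Finset.mem_range] at hi'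
    have := hf (by simp; omega) (by simp) hin
    omega
  -- The tail lengths `n + 1 - j` met for `j < n` multiply up to `(n + 1)!`.
  have hprod : ∀ m ≤ n, (n + 1).factorial = (n + 1 - m).factorial * ∏ j ∈ Finset.range m, (n + 1 - j) := by
    intro m hm
    induction m with
    | zero => simp
    | succ m ih =>
      rw [ih (by omega), Finset.prod_range_succ, show n + 1 - m = n + 1 - (m + 1) + 1 by omega,
        Nat.factorial_succ]
      ring
  have hprod' : (n + 1).factorial = ∏ j ∈ Finset.range n, (n + 1 - j) := by
    rw [hprod n le_rfl, show n + 1 - n = 1 by omega, Nat.factorial_one, one_mul]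
  have hIoc : ∏ k ∈ Finset.Ioc r (r + n), u q k = ∏ j ∈ Finset.range n, u q (r + j + 1) := by
    clear * -
    induction n with
    | zero => simp
    | succ n ih =>
      rw [← add_assoc, ← Finset.insert_Ioc_right_eq_Ioc_add_one (by omega),
        Finset.prod_insert (by simp), ih, Finset.prod_range_succ, mul_comm]
  rw [herase, Finset.prod_image (hf.mono fun i hi' => by simp at hi' ⊢; omega), hIoc, hprod',
    ← Finset.prod_mul_distrib, Nat.cast_prod, ← Finset.prod_mul_distrib]
  calc (q : ℝ) ^ n = ∏ j ∈ Finset.range n, (q : ℝ) := by simp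
    _ ≤ _ := by
      refine Finset.prod_le_prod (fun _ _ => by positivity) fun j hj => ?_
      rw [Finset.mem_range] at hj
      have h1 := hlow (r + j) (by omega)
      rw [show r + n + 1 - (r + j) = n + 1 - j by omega] at h1
      exact h1.trans (mul_le_mul_of_nonneg_left (hcomp j hj) (by positivity))

/-! ### Geometry of numbers. -/

/-- Minkowski's theorem for the parallelepiped `|x i - (∑ x) b i| < c i`. -/
theorem exists_int_abs_sub_sum_mul_lt {ι : Type*} [Fintype ι] (b c : ι → ℝ) (hc : ∀ i, 0 < c i)
    (hb : ∑ i, b i < 1) (hprod : 1 - ∑ i, b i < ∏ i, c i) :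
    ∃ m : ι → ℤ, m ≠ 0 ∧ ∀ i, |(m i : ℝ) - (∑ j, (m j : ℝ)) * b i| < c i := by
  classical
  set σ : ℝ := 1 - ∑ i, b i with hσ
  have hσ0 : 0 < σ := by linarith
  -- A rank-one perturbation of the identity, so its determinant is `1 - ∑ b`; the parallelepiped is
  -- the preimage of a box under it.
  let M : Matrix ι ι ℝ :=
    1 + Matrix.replicateCol Unit (-b) * Matrix.replicateRow Unit (fun _ => (1 : ℝ))
  have hdet : M.det = σ := by
    rw [Matrix.det_one_add_replicateCol_mul_replicateRow]
    simp [dotProduct, hσ, sub_eq_add_neg]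
  have hM : ∀ x : ι → ℝ, Matrix.toLin' M x = fun i => x i - (∑ j, x j) * b i := by
    intro x
    ext i
    simp only [Matrix.toLin'_apply, M, Matrix.add_mulVec, Matrix.one_mulVec, Pi.add_apply,
      ← Matrix.mulVec_mulVec]
    simp [Matrix.mulVec, dotProduct, Matrix.replicateCol, Matrix.replicateRow]
    ring
  have hdet' : LinearMap.det (Matrix.toLin' M) = σ := by rw [LinearMap.det_toLin', hdet]
  let B : Set (ι → ℝ) := Set.univ.pi fun i => Set.Ioo (-c i) (c i)
  have hBmem : ∀ x : ι → ℝ, x ∈ B ↔ ∀ i, |x i| < c i := fun x => by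
    simp [B, abs_lt]
  have hBconv : Convex ℝ B := convex_pi fun i _ => convex_Ioo _ _
  have hvol : volume (Matrix.toLin' M ⁻¹' B) = ENNReal.ofReal (σ⁻¹ * (2 ^ Fintype.card ι * ∏ i, c i)) := by
    rw [Measure.addHaar_preimage_linearMap _ (by rw [hdet']; exact hσ0.ne'), hdet',
      Real.volume_pi_Ioo, ENNReal.ofReal_mul (by positivity), abs_of_pos (by positivity)]
    congr 1
    rw [← Finset.card_univ, ← Finset.prod_const, ← Finset.prod_mul_distrib,
      ENNReal.ofReal_prod_of_nonneg (fun i _ => by have := hc i; positivity)]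
    exact Finset.prod_congr rfl fun i _ => by congr 1; ring
  have hfund : volume (ZSpan.fundamentalDomain (Pi.basisFun ℝ ι)) = 1 := by
    rw [ZSpan.fundamentalDomain_pi_basisFun, Real.volume_pi_Ico]
    simp
  have : Countable (Submodule.span ℤ (Set.range (Pi.basisFun ℝ ι))).toAddSubgroup :=
    inferInstanceAs (Countable (Submodule.span ℤ (Set.range (Pi.basisFun ℝ ι))))
  obtain ⟨x, hx0, hx⟩ := exists_ne_zero_mem_lattice_of_measure_mul_two_pow_lt_measure
    (μ := (volume : Measure (ι → ℝ))) (s := Matrix.toLin' M ⁻¹' B)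
    (ZSpan.isAddFundamentalDomain' (Pi.basisFun ℝ ι) volume)
    (fun x hx => by
      rw [Set.mem_preimage, hBmem] at hx ⊢
      intro i
      rw [map_neg, Pi.neg_apply, abs_neg]
      exact hx i)
    (hBconv.linear_preimage _)
    (by
      rw [hvol, hfund, one_mul, Module.finrank_fintype_fun_eq_card,
        show (2 : ℝ≥0∞) = ENNReal.ofReal 2 by simp, ← ENNReal.ofReal_pow (by norm_num)]
      refine (ENNReal.ofReal_lt_ofReal_iff_of_nonneg (by positivity)).2 ?_
      rw [← div_eq_inv_mul, lt_div_iff₀ hσ0]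
      exact mul_lt_mul_of_pos_left hprod (by positivity))
  have hmem := ((Pi.basisFun ℝ ι).mem_span_iff_repr_mem ℤ (x : ι → ℝ)).1 x.2
  choose m hm using hmem
  have hxm : (x : ι → ℝ) = fun i => (m i : ℝ) := by
    ext i
    have := hm i
    simpa using this.symm
  refine ⟨m, ?_, ?_⟩
  · rintro rfl
    refine hx0 (Subtype.ext ?_)
    rw [hxm]
    ext i
    simp
  · rw [Set.mem_preimage, hBmem, hM, hxm] at hx
    exact hx

/-! ### Volumes of corner simplices. -/

theorem lintegral_Icc_ofReal_sub_mul_pow (n : ℕ) {a T : ℝ} (ha : 0 < a) (hT : 0 ≤ T) (C : ℝ) (hC : 0 ≤ C) :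
    ∫⁻ x in Set.Icc 0 (T / a), ENNReal.ofReal (C * (T - a * x) ^ n) =
      ENNReal.ofReal (C * (T ^ (n + 1) / ((n + 1) * a))) := by
  have h0 : 0 ≤ T / a := by positivity
  rw [← ofReal_integral_eq_lintegral_ofReal]
  · congr 1
    rw [integral_Icc_eq_integral_Ioc, ← intervalIntegral.integral_of_le h0,
      intervalIntegral.integral_const_mul]
    congr 1
    have h1 : ∀ x ∈ Set.uIcc 0 (T / a),
        HasDerivAt (fun x => -(T - a * x) ^ (n + 1) / ((n + 1) * a)) ((T - a * x) ^ n) x := by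
      intro x _
      have h2 : HasDerivAt (fun x => T - a * x) (-a) x := by
        simpa using ((hasDerivAt_id x).const_mul a).const_sub T
      have h3 := ((h2.pow (n + 1)).neg).div_const (((n : ℝ) + 1) * a)
      convert! h3 using 1
      push_cast
      field_simp
    rw [intervalIntegral.integral_eq_sub_of_hasDerivAt h1
      (Continuous.intervalIntegrable (by fun_prop) _ _)]
    rw [mul_div_cancel₀ T ha.ne']
    simp
    ring
  · exact (Continuous.continuousOn (by fun_prop)).integrableOn_Icc
  · refine (ae_restrict_iff' measurableSet_Icc).2 (ae_of_all _ fun x hx => ?_)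
    have : a * x ≤ T := by
      have := (le_div_iff₀ ha).1 hx.2
      linarith
    have : 0 ≤ T - a * x := by linarith
    positivity

/-- The corner simplex `{y ≥ 0 : ∑ b i * y i ≤ T}`. -/
def cornerSimplex {ι : Type*} [Fintype ι] (b : ι → ℝ) (T : ℝ) : Set (ι → ℝ) :=
  {y | (∀ i, 0 ≤ y i) ∧ ∑ i, b i * y i ≤ T}

theorem isClosed_cornerSimplex {ι : Type*} [Fintype ι] (b : ι → ℝ) (T : ℝ) :
    IsClosed (cornerSimplex b T) := by
  have h : cornerSimplex b T = (⋂ i, {y | 0 ≤ y i}) ∩ {y | ∑ i, b i * y i ≤ T} := by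
    ext y
    simp [cornerSimplex]
  rw [h]
  exact (isClosed_iInter fun i => isClosed_le (by fun_prop) (by fun_prop)).inter
    (isClosed_le (by fun_prop) (by fun_prop))

/-- Fubini in the first coordinate: the slice at `x` is a corner simplex with `T` replaced by `T - b
0 * x`. -/
theorem volume_cornerSimplex_fin (n : ℕ) (b : Fin n → ℝ) (hb : ∀ i, 0 < b i) {T : ℝ} (hT : 0 ≤ T) :
    volume (cornerSimplex b T) ≤ ENNReal.ofReal ((n.factorial * ∏ i, b i)⁻¹ * T ^ n) := by
  induction n generalizing T with
  | zero =>
    refine (measure_mono (Set.subset_univ _)).trans ?_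
    rw [← Set.pi_univ Set.univ, volume_pi_pi]
    simp
  | succ n ih =>
    have hmp := (volume_preserving_piFinSuccAbove (fun _ : Fin (n + 1) => ℝ) 0).symm
    rw [← hmp.measure_preimage (isClosed_cornerSimplex b T).measurableSet.nullMeasurableSet]
    have hms := hmp.measurable (isClosed_cornerSimplex b T).measurableSet
    have hpos : (0 : ℝ) < n.factorial * ∏ i : Fin n, b i.succ :=
      mul_pos (by positivity) (Finset.prod_pos fun i _ => hb _)
    rw [Measure.volume_eq_prod, Measure.prod_apply hms]
    calc _ ≤ ∫⁻ x, (Set.Icc 0 (T / b 0)).indicator (fun x => ENNReal.ofReal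
            ((n.factorial * ∏ i : Fin n, b i.succ)⁻¹ * (T - b 0 * x) ^ n)) x := by
          refine lintegral_mono fun x => ?_
          have hsl : (Prod.mk x ⁻¹' ((MeasurableEquiv.piFinSuccAbove (fun _ : Fin (n + 1) => ℝ) 0).symm ⁻¹'
              cornerSimplex b T)) ⊆
              {z | 0 ≤ x ∧ z ∈ cornerSimplex (fun i : Fin n => b i.succ) (T - b 0 * x)} := by
            intro z hz
            simp only [Set.mem_preimage, cornerSimplex, Set.mem_ofPred_eq, MeasurableEquiv.piFinSuccAbove_symm_apply,
              Fin.sum_univ_succ, Fin.forall_fin_succ] at hz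
            simp [Fin.insertNthEquiv] at hz
            exact ⟨hz.1.1, hz.1.2, by linarith [hz.2]⟩
          by_cases hx : x ∈ Set.Icc 0 (T / b 0)
          · rw [Set.indicator_of_mem hx]
            have : b 0 * x ≤ T := by
              have := (le_div_iff₀ (hb 0)).1 hx.2
              linarith
            exact (measure_mono (hsl.trans fun z hz => hz.2)).trans
              (ih _ (fun i => hb _) (by linarith))
          · rw [Set.indicator_of_notMem hx, nonpos_iff_eq_zero]
            refine measure_mono_null hsl (measure_mono_null (t := ∅) (fun z hz => hx ⟨hz.1, ?_⟩) (by simp))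
            rw [le_div_iff₀ (hb 0)]
            have : 0 ≤ ∑ i : Fin n, b i.succ * z i :=
              Finset.sum_nonneg fun i _ => mul_nonneg (hb _).le (hz.2.1 i)
            linarith [hz.2.2]
      _ = ∫⁻ x in Set.Icc 0 (T / b 0), ENNReal.ofReal
            ((n.factorial * ∏ i : Fin n, b i.succ)⁻¹ * (T - b 0 * x) ^ n) :=
          lintegral_indicator measurableSet_Icc _
      _ = _ := by
          rw [lintegral_Icc_ofReal_sub_mul_pow n (hb 0) hT _ (by positivity)]
          congr 1
          rw [Fin.prod_univ_succ, Nat.factorial_succ]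
          push_cast
          have := hb 0
          have h4 : ∏ i : Fin n, b i.succ ≠ 0 := (Finset.prod_pos fun i _ => hb _).ne'
          field_simp

theorem volume_cornerSimplex_le {ι : Type*} [Fintype ι] (b : ι → ℝ) (hb : ∀ i, 0 < b i) :
    volume (cornerSimplex b 1) ≤
      ENNReal.ofReal (((Fintype.card ι).factorial * ∏ i, b i)⁻¹) := by
  let e := (Fintype.equivFin ι).symm
  have hmp := volume_measurePreserving_piCongrLeft (fun _ : ι => ℝ) e
  rw [← hmp.measure_preimage (isClosed_cornerSimplex b 1).measurableSet.nullMeasurableSet]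
  have h1 := volume_cornerSimplex_fin _ (fun i => b (e i)) (fun i => hb _) (T := 1) zero_le_one
  rw [e.prod_comp b, one_pow, mul_one] at h1
  refine le_trans (measure_mono fun y hy => ?_) h1
  simp only [Set.mem_preimage, cornerSimplex, Set.mem_ofPred_eq, MeasurableEquiv.coe_piCongrLeft] at hy ⊢
  have h2 : ∀ i, Equiv.piCongrLeft (fun _ : ι => ℝ) e y (e i) = y i := fun i =>
    Equiv.piCongrLeft_apply_apply (fun _ : ι => ℝ) e y i
  refine ⟨fun i => h2 i ▸ hy.1 (e i), ?_⟩
  rw [← e.sum_comp] at hy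
  simp only [h2] at hy
  exact hy.2

/-- The volume of a product of corner simplices. -/
theorem volume_forall_cornerSimplex_le {ι : Type*} [Fintype ι] {κ : ι → Type*} [∀ i, Fintype (κ i)]
    (b : ∀ i, κ i → ℝ) (hb : ∀ i j, 0 < b i j) :
    volume {y : (Σ i, κ i) → ℝ | ∀ i, (fun j => y ⟨i, j⟩) ∈ cornerSimplex (b i) 1} ≤
      ∏ i, ENNReal.ofReal (((Fintype.card (κ i)).factorial * ∏ j, b i j)⁻¹) := by
  have hmp : MeasurePreserving (MeasurableEquiv.piCurry (fun (i : ι) (_ : κ i) => ℝ)).symm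
      volume volume := by
    refine ⟨MeasurableEquiv.measurable _, (Measure.pi_eq fun s hs => ?_).symm⟩
    rw [Measure.map_apply (MeasurableEquiv.measurable _) (.univ_pi hs), Fintype.prod_sigma]
    have : (MeasurableEquiv.piCurry (fun (i : ι) (_ : κ i) => ℝ)).symm ⁻¹' Set.univ.pi s =
        Set.univ.pi fun i => Set.univ.pi fun j => s ⟨i, j⟩ := by
      ext y
      simp [MeasurableEquiv.coe_piCurry_symm, Sigma.uncurry, Sigma.forall]
    rw [this, volume_pi_pi]
    simp_rw [volume_pi_pi]
  have hcl : MeasurableSet {y : (Σ i, κ i) → ℝ | ∀ i, (fun j => y ⟨i, j⟩) ∈ cornerSimplex (b i) 1} := by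
    simp only [Set.ofPred_forall]
    exact MeasurableSet.iInter fun i => (isClosed_cornerSimplex (b i) 1).measurableSet.preimage
      (by fun_prop)
  rw [← hmp.measure_preimage hcl.nullMeasurableSet]
  have : (MeasurableEquiv.piCurry (fun (i : ι) (_ : κ i) => ℝ)).symm ⁻¹'
      {y : (Σ i, κ i) → ℝ | ∀ i, (fun j => y ⟨i, j⟩) ∈ cornerSimplex (b i) 1} =
        Set.univ.pi fun i => cornerSimplex (b i) 1 := by
    ext y
    simp [MeasurableEquiv.coe_piCurry_symm, Sigma.uncurry]
  rw [this, volume_pi_pi]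
  exact Finset.prod_le_prod' fun i _ => volume_cornerSimplex_le (b i) (hb i)

/-! ### Relative interiors and barycentric coordinates of lattice simplices. -/

theorem IsPolytope.isClosed {d : ℕ} {P : Set (Fin d → ℝ)} (hP : IsPolytope P) : IsClosed P := by
  obtain ⟨-, H, -, rfl⟩ := hP
  have : {x : Fin d → ℝ | ∀ h ∈ H, h.1 ⬝ᵥ x ≤ h.2} = ⋂ h ∈ H, {x | h.1 ⬝ᵥ x ≤ h.2} := by
    ext x
    simp
  rw [this]
  exact isClosed_biInter fun h _ => isClosed_le (continuous_const.dotProduct continuous_id) continuous_const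

theorem IsPolytope.convex {d : ℕ} {P : Set (Fin d → ℝ)} (hP : IsPolytope P) : Convex ℝ P := by
  obtain ⟨-, H, -, rfl⟩ := hP
  intro x hx y hy a b ha hb hab h hh
  rw [dotProduct_add, dotProduct_smul, dotProduct_smul, smul_eq_mul, smul_eq_mul]
  have h1 := mul_le_mul_of_nonneg_left (hx h hh) ha
  have h2 := mul_le_mul_of_nonneg_left (hy h hh) hb
  calc _ ≤ a * h.2 + b * h.2 := add_le_add h1 h2
    _ = h.2 := by rw [← add_mul, hab, one_mul]

theorem IsPolytope.isCompact {d : ℕ} {P : Set (Fin d → ℝ)} (hP : IsPolytope P) : IsCompact P :=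
  Metric.isCompact_of_isClosed_isBounded hP.isClosed hP.1

theorem IsPolytope.eq_convexHull_vert {d : ℕ} {P : Set (Fin d → ℝ)} (hP : IsPolytope P)
    (hfin : (vert P).Finite) : P = convexHull ℝ (vert P) := by
  have h := closure_convexHull_extremePoints hP.isCompact hP.convex
  rw [show P.extremePoints ℝ = vert P from rfl, (hfin.isClosed_convexHull ℝ).closure_eq] at h
  exact h.symm

theorem exists_ball_of_mem_intrinsicInterior {d : ℕ} {S : Set (Fin d → ℝ)} {x : Fin d → ℝ}
    (hx : x ∈ intrinsicInterior ℝ S) :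
    ∃ δ > 0, ∀ y ∈ affineSpan ℝ S, dist y x < δ → y ∈ S := by
  obtain ⟨y, hy, rfl⟩ := mem_intrinsicInterior.1 hx
  obtain ⟨δ, hδ, h⟩ := Metric.mem_nhds_iff.1 (mem_interior_iff_mem_nhds.1 hy)
  exact ⟨δ, hδ, fun z hz hzd => h (a := ⟨z, hz⟩) hzd⟩

theorem mem_intrinsicInterior_of_ball {d : ℕ} {S : Set (Fin d → ℝ)} {x : Fin d → ℝ} {δ : ℝ}
    (hδ : 0 < δ) (hxS : x ∈ S) (h : ∀ y ∈ affineSpan ℝ S, dist y x < δ → y ∈ S) :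
    x ∈ intrinsicInterior ℝ S := by
  refine mem_intrinsicInterior.2 ⟨⟨x, subset_affineSpan ℝ S hxS⟩, ?_, rfl⟩
  exact mem_interior_iff_mem_nhds.2 (Metric.mem_nhds_iff.2 ⟨δ, hδ, fun z hz => h z z.2 hz⟩)

theorem mem_affineSpan_of_mem_span {d : ℕ} {S : Set (Fin d → ℝ)} (h0 : 0 ∈ S) {x : Fin d → ℝ}
    (hx : x ∈ Submodule.span ℝ S) : x ∈ affineSpan ℝ S := by
  have h := affineSpan_insert_zero (k := ℝ) S
  rw [Set.insert_eq_of_mem h0] at h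
  exact (Set.ext_iff.1 h x).2 hx

/-- The origin is a strictly positive convex combination of `X` if it is in the relative interior of
the convex hull. -/
theorem exists_pos_weights {d : ℕ} {X : Finset (Fin d → ℝ)}
    (h0 : (0 : Fin d → ℝ) ∈ intrinsicInterior ℝ (convexHull ℝ (X : Set (Fin d → ℝ)))) :
    ∃ β : (Fin d → ℝ) → ℝ, (∀ v ∈ X, 0 < β v) ∧ ∑ v ∈ X, β v = 1 ∧ ∑ v ∈ X, β v • v = 0 := by
  classical
  have h0S := intrinsicInterior_subset h0
  obtain ⟨δ, hδ, hball⟩ := exists_ball_of_mem_intrinsicInterior h0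
  have hX : X.Nonempty := by
    rw [← Finset.coe_nonempty, ← convexHull_nonempty_iff (𝕜 := ℝ)]
    exact ⟨0, h0S⟩
  have key : ∀ v ∈ X, ∃ c : (Fin d → ℝ) → ℝ, (∀ y ∈ X, 0 ≤ c y) ∧ 0 < c v ∧ ∑ y ∈ X, c y = 1 ∧
      ∑ y ∈ X, c y • y = 0 := by
    intro v hv
    -- Small enough that `-s v` stays in the hull. Adding `s v` to its convex representation gives a
    -- relation with positive weight at `v`; averaging over `v` makes all weights positive.
    set s : ℝ := δ / (2 * (‖v‖ + 1)) with hs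
    have hs0 : 0 < s := by positivity
    have hmem : (-s) • v ∈ convexHull ℝ (X : Set (Fin d → ℝ)) := by
      refine hball _ (mem_affineSpan_of_mem_span h0S (Submodule.smul_mem _ _
        (Submodule.subset_span (subset_convexHull ℝ _ hv)))) ?_
      rw [dist_zero_right, norm_smul, norm_neg, Real.norm_of_nonneg hs0.le, hs, div_mul_eq_mul_div,
        div_lt_iff₀ (by positivity)]
      nlinarith [norm_nonneg v]
    obtain ⟨w, hw0, hw1, hwv⟩ := Finset.mem_convexHull'.1 hmem
    have hss : ∀ y ∈ X, 0 ≤ (if y = v then s else 0) := fun y _ => by split_ifs <;> linarith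
    refine ⟨fun y => (1 + s)⁻¹ * (w y + if y = v then s else 0), fun y hy => ?_, ?_, ?_, ?_⟩
    · have := hw0 y hy
      have := hss y hy
      positivity
    · have := hw0 v hv
      simp only [if_true]
      positivity
    · rw [← Finset.mul_sum, Finset.sum_add_distrib, hw1, Finset.sum_ite_eq' X v, if_pos hv]
      exact inv_mul_cancel₀ (by positivity)
    · simp only [mul_smul, ← Finset.smul_sum, add_smul, Finset.sum_add_distrib, hwv, ite_smul, zero_smul]
      rw [Finset.sum_ite_eq' X v, if_pos hv]
      simp
  choose! c hc0 hcv hc1 hcs using key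
  have hcard : (0 : ℝ) < X.card := by exact_mod_cast hX.card_pos
  refine ⟨fun y => (X.card : ℝ)⁻¹ * ∑ v ∈ X, c v y, fun y hy => ?_, ?_, ?_⟩
  · exact mul_pos (inv_pos.2 hcard) (Finset.sum_pos' (fun v hv => hc0 v hv y hy) ⟨y, hy, hcv y hy⟩)
  · rw [← Finset.mul_sum, Finset.sum_comm, Finset.sum_congr rfl hc1]
    simp [hcard.ne']
  · simp only [mul_smul, ← Finset.smul_sum, Finset.sum_smul]
    rw [Finset.sum_comm, Finset.sum_congr rfl hcs]
    simp

/-- Points with strictly positive weights are in the relative interior, for dilates of convex hulls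
with the origin in the relative interior. -/
theorem mem_intrinsicInterior_smul_convexHull {d : ℕ} {X : Finset (Fin d → ℝ)}
    (h0 : (0 : Fin d → ℝ) ∈ intrinsicInterior ℝ (convexHull ℝ (X : Set (Fin d → ℝ))))
    {β b : (Fin d → ℝ) → ℝ} (hβ : ∀ v ∈ X, 0 < β v) (hβ1 : ∑ v ∈ X, β v = 1)
    (hβ0 : ∑ v ∈ X, β v • v = 0) (hb : ∀ v ∈ X, 0 < b v) (hb1 : ∑ v ∈ X, b v = 1)
    {r : ℝ} (hr : 0 < r) {x : Fin d → ℝ} (hx : ∑ v ∈ X, b v • v = r • x) :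
    x ∈ intrinsicInterior ℝ ((1 / r) • convexHull ℝ (X : Set (Fin d → ℝ))) := by
  set S := convexHull ℝ (X : Set (Fin d → ℝ)) with hS
  have h0S := intrinsicInterior_subset h0
  obtain ⟨δ, hδ, hball⟩ := exists_ball_of_mem_intrinsicInterior h0
  have hX : X.Nonempty := by
    rw [← Finset.coe_nonempty, ← convexHull_nonempty_iff (𝕜 := ℝ)]
    exact ⟨0, h0S⟩
  obtain ⟨v₀, hv₀, hmin⟩ := X.exists_min_image b hX
  set ρ := b v₀
  have hρ : 0 < ρ := hb v₀ hv₀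
  have hβle : ∀ v ∈ X, β v ≤ 1 := fun v hv =>
    hβ1 ▸ Finset.single_le_sum (f := β) (fun w hw => (hβ w hw).le) hv
  have hsmul : ∀ z, r • z ∈ S → z ∈ (1 / r) • S := fun z hz =>
    ⟨r • z, hz, by simp [smul_smul, hr.ne']⟩
  have hxS : x ∈ (1 / r) • S :=
    hsmul x (Finset.mem_convexHull'.2 ⟨b, fun v hv => (hb v hv).le, hb1, hx⟩)
  have hspan : Submodule.span ℝ ((1 / r) • S) ≤ Submodule.span ℝ S := by
    rw [Submodule.span_le]
    rintro _ ⟨y, hy, rfl⟩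
    exact Submodule.smul_mem _ _ (Submodule.subset_span hy)
  refine mem_intrinsicInterior_of_ball (δ := ρ * δ / r) (by positivity) hxS fun z hz hzx => ?_
  have hzx' : z - x ∈ Submodule.span ℝ S :=
    hspan (Submodule.sub_mem _ (affineSpan_subset_span hz) (Submodule.subset_span hxS))
  have hmem : (r / ρ) • (z - x) ∈ S := by
    refine hball _ (mem_affineSpan_of_mem_span h0S (Submodule.smul_mem _ _ hzx')) ?_
    rw [dist_zero_right, norm_smul, Real.norm_of_nonneg (by positivity), ← dist_eq_norm,
      div_mul_eq_mul_div, div_lt_iff₀ hρ]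
    rw [lt_div_iff₀ hr] at hzx
    linarith
  obtain ⟨w, hw0, hw1, hwv⟩ := Finset.mem_convexHull'.1 hmem
  -- Replace a share `ρ` of the weights `β`, which represent 0, by the weights `w` of the
  -- displacement. As `ρ` is the minimum of `b` and `β ≤ 1`, nothing becomes negative.
  refine hsmul z (Finset.mem_convexHull'.2 ⟨fun v => b v - ρ * β v + ρ * w v, fun v hv => ?_, ?_, ?_⟩)
  · have h1 := mul_nonneg hρ.le (hw0 v hv)
    have h2 := hmin v hv
    have h3 := mul_le_mul_of_nonneg_left (hβle v hv) hρ.le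
    linarith
  · rw [Finset.sum_add_distrib, Finset.sum_sub_distrib, ← Finset.mul_sum, ← Finset.mul_sum, hb1, hβ1,
      hw1]
    ring
  · simp only [add_smul, sub_smul, mul_smul, Finset.sum_add_distrib, Finset.sum_sub_distrib,
      ← Finset.smul_sum, hx, hβ0, hwv]
    rw [smul_smul, mul_div_cancel₀ r hρ.ne']
    module

theorem eq_zero_of_sum_smul_eq_zero_of_affineIndependent {d : ℕ} {X : Finset (Fin d → ℝ)}
    (hX : AffineIndependent ℝ ((↑) : X → Fin d → ℝ)) {c : (Fin d → ℝ) → ℝ}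
    (hc : ∑ v ∈ X, c v = 0) (hcv : ∑ v ∈ X, c v • v = 0) : ∀ v ∈ X, c v = 0 := by
  intro v hv
  refine affineIndependent_iff.1 hX Finset.univ (fun v => c v) ?_ ?_ ⟨v, hv⟩ (Finset.mem_univ _)
  · rwa [Finset.sum_coe_sort X c]
  · rwa [Finset.sum_coe_sort X (fun v => c v • v)]

/-- A linear relation between the vertices of a simplex which omits a vertex is trivial. -/
theorem eq_zero_of_sum_smul_eq_zero {d : ℕ} {X : Finset (Fin d → ℝ)}
    (hX : AffineIndependent ℝ ((↑) : X → Fin d → ℝ)) {β c : (Fin d → ℝ) → ℝ}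
    (hβ : ∀ v ∈ X, 0 < β v) (hβ1 : ∑ v ∈ X, β v = 1) (hβ0 : ∑ v ∈ X, β v • v = 0)
    (hcv : ∑ v ∈ X, c v • v = 0) {w : Fin d → ℝ} (hw : w ∈ X) (hcw : c w = 0) :
    ∀ v ∈ X, c v = 0 := by
  -- Subtracting this multiple of the relation `β` makes the coefficients sum to zero. So `c` is
  -- proportional to `β`, which vanishes nowhere.
  have h := eq_zero_of_sum_smul_eq_zero_of_affineIndependent hX
    (c := fun v => c v - (∑ y ∈ X, c y) * β v)
    (by rw [Finset.sum_sub_distrib, ← Finset.mul_sum, hβ1]; ring)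
    (by simp only [sub_smul, mul_smul, Finset.sum_sub_distrib, ← Finset.smul_sum, hβ0, hcv]; simp)
  have h0 : ∑ y ∈ X, c y = 0 := by
    have h1 := h w hw
    simp only [hcw, zero_sub, neg_eq_zero, mul_eq_zero] at h1
    exact h1.resolve_right (hβ w hw).ne'
  intro v hv
  simpa [h0] using h v hv

theorem sum_intCast_smul_mem_latticePoints {d : ℕ} {X : Finset (Fin d → ℝ)}
    (hX : ∀ v ∈ X, IsPrimitiveLatticePoint v) (m : (Fin d → ℝ) → ℤ) :
    ∑ v ∈ X, (m v : ℝ) • v ∈ latticePoints d := by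
  have : ∀ v ∈ X, ∃ n : Fin d → ℤ, v = fun i => (n i : ℝ) := fun v hv => by
    obtain ⟨n, hn, -⟩ := hX v hv
    exact ⟨n, hn⟩
  choose! n hn using this
  refine ⟨∑ v ∈ X, m v • n v, ?_⟩
  ext i
  simp only [Finset.sum_apply, Pi.smul_apply, smul_eq_mul, Int.cast_sum, Int.cast_mul]
  exact Finset.sum_congr rfl fun v hv => by rw [congrFun (hn v hv) i]

/-- Product-sum inequalities for the barycentric coordinates of the origin. -/
theorem prod_le_pow_mul_sum_sdiff {d q : ℕ} (hq : 1 ≤ q) {X : Finset (Fin d → ℝ)}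
    [DecidableEq (Fin d → ℝ)]
    (hX : AffineIndependent ℝ ((↑) : X → Fin d → ℝ)) (hprim : ∀ v ∈ X, IsPrimitiveLatticePoint v)
    (h0 : (0 : Fin d → ℝ) ∈ intrinsicInterior ℝ (convexHull ℝ (X : Set (Fin d → ℝ))))
    (hlc : intrinsicInterior ℝ ((1 / (q : ℝ)) • convexHull ℝ (X : Set (Fin d → ℝ))) ∩
      latticePoints d = {0})
    {β : (Fin d → ℝ) → ℝ} (hβ : ∀ v ∈ X, 0 < β v) (hβ1 : ∑ v ∈ X, β v = 1)
    (hβ0 : ∑ v ∈ X, β v • v = 0) {A : Finset (Fin d → ℝ)} (hA : A ⊂ X) :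
    ∏ v ∈ A, β v ≤ q ^ A.card * ∑ v ∈ X \ A, β v := by
  by_contra! hlt
  have hq0 : (0 : ℝ) < q := by exact_mod_cast hq
  obtain ⟨w, hwX, hwA⟩ := Finset.exists_of_ssubset hA
  have hsum : ∑ v ∈ X \ A, β v = 1 - ∑ v ∈ A, β v := by
    rw [← hβ1, ← Finset.sum_sdiff hA.1]
    ring
  have hpos : 0 < ∑ v ∈ X \ A, β v :=
    Finset.sum_pos (fun v hv => hβ v (Finset.mem_sdiff.1 hv).1) ⟨w, Finset.mem_sdiff.2 ⟨hwX, hwA⟩⟩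
  obtain ⟨m, hm0, hm⟩ := exists_int_abs_sub_sum_mul_lt (ι := A) (fun v => β v) (fun v => β v / q)
    (fun v => div_pos (hβ v (hA.1 v.2)) hq0)
    (by rw [Finset.sum_coe_sort A β]; linarith)
    (by
      rw [Finset.sum_coe_sort A β, Finset.prod_coe_sort A (fun v => β v / q), ← hsum,
        Finset.prod_div_distrib, Finset.prod_const, lt_div_iff₀ (by positivity)]
      linarith)
  -- The conditions are symmetric under `m ↦ -m`. The sign is chosen so that the weights built below
  -- stay positive on vertices outside `A`.
  obtain ⟨m, hm0, hM, hm⟩ : ∃ m : A → ℤ, m ≠ 0 ∧ (∑ j, (m j : ℝ)) ≤ 0 ∧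
      ∀ i : A, |(m i : ℝ) - (∑ j, (m j : ℝ)) * β i| < β i / q := by
    rcases le_total (∑ j, (m j : ℝ)) 0 with h | h
    · exact ⟨m, hm0, h, hm⟩
    · refine ⟨-m, neg_ne_zero.2 hm0, by simpa using h, fun i => ?_⟩
      rw [← abs_neg]
      convert hm i using 2
      simp
      ring
  let M : (Fin d → ℝ) → ℤ := fun v => if hv : v ∈ A then m ⟨v, hv⟩ else 0
  have hMA : ∀ v (hv : v ∈ A), M v = m ⟨v, hv⟩ := fun v hv => dif_pos hv
  have hMn : ∀ v, v ∉ A → M v = 0 := fun v hv => dif_neg hv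
  have hMs : ∑ v ∈ X, (M v : ℝ) = ∑ j, (m j : ℝ) := by
    rw [← Finset.sum_subset hA.1 (fun v _ hv => by rw [hMn v hv, Int.cast_zero]),
      ← Finset.sum_coe_sort A]
    exact Finset.sum_congr rfl fun v _ => by rw [hMA v v.2]
  set N : ℝ := ∑ j, (m j : ℝ)
  -- These weights represent `q x`. On `A` they are positive by the Minkowski bound; off `A` they
  -- equal `(1 - q N) β v` with `N ≤ 0`.
  have hint := mem_intrinsicInterior_smul_convexHull h0 hβ hβ1 hβ0
    (b := fun v => β v + q * (M v - N * β v)) (r := q) (x := ∑ v ∈ X, (M v : ℝ) • v)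
    (fun v hv => by
      by_cases hvA : v ∈ A
      · have h1 := (abs_lt.1 (hm ⟨v, hvA⟩)).1
        rw [hMA v hvA]
        have h2 : q * (β v / q) = β v := mul_div_cancel₀ _ hq0.ne'
        have h3 := mul_lt_mul_of_pos_left h1 hq0
        simp only [mul_neg, h2] at h3
        linarith
      · rw [hMn v hvA]
        have := hβ v hv
        have h1 : 0 ≤ q * (-N * β v) := mul_nonneg hq0.le (mul_nonneg (by linarith) this.le)
        push_cast
        linarith)
    (by
      rw [Finset.sum_add_distrib, ← Finset.mul_sum, Finset.sum_sub_distrib, ← Finset.mul_sum, hβ1, hMs]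
      ring)
    hq0
    (by
      simp only [add_smul, sub_smul, mul_smul, Finset.sum_add_distrib, Finset.sum_sub_distrib,
        ← Finset.smul_sum, hβ0]
      simp)
  have hzero : ∑ v ∈ X, (M v : ℝ) • v = 0 := by
    have : ∑ v ∈ X, (M v : ℝ) • v ∈ ({0} : Set (Fin d → ℝ)) :=
      hlc ▸ ⟨hint, sum_intCast_smul_mem_latticePoints hprim M⟩
    exact this
  have hall := eq_zero_of_sum_smul_eq_zero hX hβ hβ1 hβ0 hzero hwX (by rw [hMn w hwA, Int.cast_zero])
  refine hm0 (funext fun v => ?_)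
  have := hall v (hA.1 v.2)
  rw [hMA v v.2] at this
  exact_mod_cast this

/-- Vertices and barycentric coordinates of the origin of an lc Fano simplex. -/
theorem IsLcFanoSimplex.exists_weights {d q : ℕ} [DecidableEq (Fin d → ℝ)] (hq : 1 ≤ q)
    {S : Set (Fin d → ℝ)} (hS : IsLcFanoSimplex (1 / (q : ℝ)) S) :
    ∃ (X : Finset (Fin d → ℝ)) (β : (Fin d → ℝ) → ℝ), (X : Set (Fin d → ℝ)) = vert S ∧
      X.card = polyDim S + 1 ∧ S = convexHull ℝ (X : Set (Fin d → ℝ)) ∧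
      (∀ v ∈ X, IsPrimitiveLatticePoint v) ∧ (∀ v ∈ X, 0 < β v) ∧ ∑ v ∈ X, β v = 1 ∧
      ∑ v ∈ X, β v • v = 0 ∧ ∀ A ⊂ X, ∏ v ∈ A, β v ≤ q ^ A.card * ∑ v ∈ X \ A, β v := by
  have hcard := hS.isSimplex.2
  have hfin : (vert S).Finite := Set.finite_of_ncard_ne_zero (by omega)
  have hhull := hS.isSimplex.1.eq_convexHull_vert hfin
  obtain ⟨X, hX⟩ := hfin.exists_finset_coe
  rw [← hX] at hhull hcard
  rw [Set.ncard_coe_finset] at hcard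
  have hprim : ∀ v ∈ X, IsPrimitiveLatticePoint v := fun v hv => hS.primitive v (hX ▸ hv)
  have haff : AffineIndependent ℝ ((↑) : X → Fin d → ℝ) := by
    rw [affineIndependent_iff_finrank_vectorSpan_eq ℝ _ (n := polyDim S) (by simpa using hcard),
      Subtype.range_coe_subtype]
    change Module.finrank ℝ (vectorSpan ℝ (X : Set (Fin d → ℝ))) = _
    rw [polyDim]
    conv_rhs => rw [hhull]
    rw [← direction_affineSpan, ← direction_affineSpan, affineSpan_convexHull]
  have h0 := hS.zero_mem
  have hlc := hS.lc
  rw [hhull] at h0 hlc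
  obtain ⟨β, hβ, hβ1, hβ0⟩ := exists_pos_weights h0
  exact ⟨X, β, hX, hcard, hhull, hprim, hβ, hβ1, hβ0, fun A hA =>
    prod_le_pow_mul_sum_sdiff hq haff hprim h0 hlc hβ hβ1 hβ0 hA⟩

/-! ### Covering the dual by a product of corner simplices. -/

theorem volume_setOf_dotProduct_add_one_le {d : ℕ} {κ : Type*} [Fintype κ] (hcard : Fintype.card κ = d)
    (v : κ → Fin d → ℝ) (hv : ∀ k, ∃ n : Fin d → ℤ, v k = fun i => (n i : ℝ))
    (hspan : Submodule.span ℝ (Set.range v) = ⊤) (Q : Set (κ → ℝ)) :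
    volume {m : Fin d → ℝ | (fun k => m ⬝ᵥ v k + 1) ∈ Q} ≤ volume Q := by
  choose n hn using hv
  let e : Fin d ≃ κ := (Fintype.equivFinOfCardEq hcard).symm
  let N : Matrix (Fin d) (Fin d) ℤ := fun i => n (e i)
  let M : Matrix (Fin d) (Fin d) ℝ := N.map (Int.castRingHom ℝ)
  have hM : ∀ i, M i = v (e i) := fun i => by rw [hn]; rfl
  have hli : LinearIndependent ℝ M.row := by
    refine linearIndependent_of_top_le_span_of_card_eq_finrank ?_ (by simp)
    have : Set.range M.row = Set.range v := by
      rw [← e.surjective.range_comp v]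
      congr 1
      exact funext hM
    rw [this, hspan]
  have hunit := (Matrix.isUnit_iff_isUnit_det M).1 (Matrix.linearIndependent_rows_iff_isUnit.1 hli)
  have hdet0 : M.det ≠ 0 := hunit.ne_zero
  have hdetN : M.det = (N.det : ℝ) := ((Int.castRingHom ℝ).map_det N).symm
  -- A nonzero integer determinant has absolute value at least 1; this is where integrality of the
  -- vertices bounds the volume.
  have hdet1 : 1 ≤ |M.det| := by
    rw [hdetN] at hdet0 ⊢
    exact_mod_cast Int.one_le_abs (by exact_mod_cast hdet0)
  let f := MeasurableEquiv.piCongrLeft (fun _ : κ => ℝ) e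
  have hset : {m : Fin d → ℝ | (fun k => m ⬝ᵥ v k + 1) ∈ Q} =
      Matrix.toLin' M ⁻¹' ((fun y => y + 1) ⁻¹' (f ⁻¹' Q)) := by
    ext m
    simp only [Set.mem_preimage, Set.mem_ofPred_eq]
    have : f (Matrix.toLin' M m + 1) = fun k => m ⬝ᵥ v k + 1 := by
      ext k
      obtain ⟨i, rfl⟩ := e.surjective k
      rw [MeasurableEquiv.coe_piCongrLeft, Equiv.piCongrLeft_apply_apply]
      simp only [Matrix.toLin'_apply, Pi.add_apply, Pi.one_apply, Matrix.mulVec, hM]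
      rw [dotProduct_comm]
    rw [this]
  rw [hset, Measure.addHaar_preimage_linearMap _ (by rwa [LinearMap.det_toLin']), LinearMap.det_toLin',
    measure_preimage_add_right,
    (volume_measurePreserving_piCongrLeft (fun _ : κ => ℝ) e).measure_preimage_equiv]
  refine mul_le_of_le_one_left' ?_
  rw [ENNReal.ofReal_le_one, abs_inv]
  exact inv_le_one_of_one_le₀ hdet1

theorem sharedVertices_eq_zero {d t : ℕ} (S : Fin t → Set (Fin d → ℝ)) {i : Fin t}
    (hi : (i : ℕ) = 0) : sharedVertices S i = 0 := by
  have h : partialHull S i = ∅ := by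
    have : ∀ j : Fin t, ¬ j < i := fun j hj => by
      have := Fin.lt_def.1 hj
      omega
    simp [partialHull, this]
  simp [sharedVertices, h, vert]

/-- Since `∑ β v = 0`, the weighted sum of `⟨m, v⟩ + 1` over all of `X i` is 1; discarding
nonnegative terms leaves at most 1 on `K i`. -/
theorem dual_subset_setOf_cornerSimplex {d t : ℕ} {P : Set (Fin d → ℝ)}
    {X K : Fin t → Finset (Fin d → ℝ)} {β : Fin t → (Fin d → ℝ) → ℝ}
    (hXP : ∀ i, (X i : Set (Fin d → ℝ)) ⊆ P) (hK : ∀ i, K i ⊆ X i)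
    (hβ : ∀ i, ∀ v ∈ X i, 0 < β i v) (hβ1 : ∀ i, ∑ v ∈ X i, β i v = 1)
    (hβ0 : ∀ i, ∑ v ∈ X i, β i v • v = 0) :
    dual P ⊆ {m | (fun k : Σ i, K i => m ⬝ᵥ (k.2 : Fin d → ℝ) + 1) ∈
      {y : (Σ i, K i) → ℝ | ∀ i, (fun j => y ⟨i, j⟩) ∈
        cornerSimplex (fun j : K i => β i j) 1}} := by
  intro m hm i
  have hpos : ∀ v ∈ X i, 0 ≤ m ⬝ᵥ v + 1 := fun v hv => hm v (hXP i hv)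
  refine ⟨fun j => hpos _ (hK i j.2), ?_⟩
  change ∑ j : K i, β i j * (m ⬝ᵥ (j : Fin d → ℝ) + 1) ≤ 1
  rw [Finset.sum_coe_sort (K i) (fun v => β i v * (m ⬝ᵥ v + 1))]
  calc _ ≤ ∑ v ∈ X i, β i v * (m ⬝ᵥ v + 1) :=
        Finset.sum_le_sum_of_subset_of_nonneg (hK i) fun v hv _ =>
          mul_nonneg (hβ i v hv).le (hpos v hv)
    _ = m ⬝ᵥ (∑ v ∈ X i, β i v • v) + ∑ v ∈ X i, β i v := by
        rw [dotProduct_sum, ← Finset.sum_add_distrib]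
        exact Finset.sum_congr rfl fun v _ => by rw [dotProduct_smul, smul_eq_mul]; ring
    _ = 1 := by rw [hβ0, hβ1, dotProduct_zero, zero_add]

/-- The unshared vertices of the simplices, with one omitted for each simplex, span. -/
theorem span_range_eq_top {d t : ℕ} [DecidableEq (Fin d → ℝ)] {P : Set (Fin d → ℝ)}
    {S : Fin t → Set (Fin d → ℝ)}
    {X K : Fin t → Finset (Fin d → ℝ)} {β : Fin t → (Fin d → ℝ) → ℝ} {w : Fin t → Fin d → ℝ}
    (hP : (interior P).Nonempty) (hPS : P = convexHull ℝ (⋃ i, S i))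
    (hSX : ∀ i, S i = convexHull ℝ (X i : Set (Fin d → ℝ)))
    (hβ : ∀ i, ∀ v ∈ X i, 0 < β i v) (hβ0 : ∀ i, ∑ v ∈ X i, β i v • v = 0)
    (hK : ∀ i, ∀ v ∈ X i, v ≠ w i → v ∈ partialHull S i ∨ v ∈ K i) :
    Submodule.span ℝ (Set.range fun k : Σ i, K i => (k.2 : Fin d → ℝ)) = ⊤ := by
  set W := Submodule.span ℝ (Set.range fun k : Σ i, K i => (k.2 : Fin d → ℝ))
  have hS : ∀ i, S i ⊆ W := by
    intro i
    induction i using WellFoundedLT.induction with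
    | _ i ih =>
      rw [hSX]
      refine convexHull_min ?_ W.convex
      have h1 : ∀ v ∈ X i, v ≠ w i → v ∈ W := by
        intro v hv hvw
        rcases hK i v hv hvw with h | h
        · refine convexHull_min ?_ W.convex h
          exact Set.iUnion₂_subset ih
        · exact Submodule.subset_span ⟨⟨i, v, h⟩, rfl⟩
      intro v hv
      -- The omitted vertex has nonzero coefficient in `∑ β v = 0`, so it lies in the span of the
      -- others.
      by_cases hvw : v = w i
      · subst hvw
        have h2 := hβ0 i
        rw [← Finset.add_sum_erase _ _ hv] at h2
        have h3 : β i (w i) • w i ∈ W := by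
          rw [eq_neg_of_add_eq_zero_left h2]
          exact W.neg_mem (W.sum_mem fun v hv' => W.smul_mem _
            (h1 v (Finset.mem_of_mem_erase hv') (Finset.ne_of_mem_erase hv')))
        exact (W.smul_mem_iff (hβ i _ hv).ne').1 h3
      · exact h1 v hv hvw
  have hPW : P ⊆ W := hPS ▸ convexHull_min (Set.iUnion_subset hS) W.convex
  exact W.eq_top_of_nonempty_interior' (hP.mono (interior_mono hPW))

/-- The quotient `(n + 1)! / n! = n + 1` is at most `2 ^ n`; over all simplices these powers
multiply to `2 ^ d`. -/
theorem inv_factorial_mul_le {q n U : ℕ} (hq : 1 ≤ q) {p : ℝ} (hp : 0 < p)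
    (h : (q : ℝ) ^ n ≤ ((n + 1).factorial * U : ℕ) * p) :
    (n.factorial * p)⁻¹ ≤ 2 ^ n * U / q ^ n := by
  have hq0 : (0 : ℝ) < q ^ n := by positivity
  rw [inv_le_iff_one_le_mul₀ (by positivity), div_mul_eq_mul_div, le_div_iff₀ hq0, one_mul]
  refine h.trans ?_
  have h2 : ((n + 1 : ℕ) : ℝ) ≤ 2 ^ n := by exact_mod_cast Nat.lt_two_pow_self (n := n)
  rw [Nat.factorial_succ]
  push_cast at h2 ⊢
  calc ((n : ℝ) + 1) * n.factorial * U * p = (n + 1) * (n.factorial * U * p) := by ring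
    _ ≤ 2 ^ n * (n.factorial * U * p) := by gcongr
    _ = _ := by ring

/-- A bound of the dual volume in terms of the dimensions and numbers of shared vertices. -/
theorem normalizedVolume_dual_le {d q t : ℕ} (hq : 1 ≤ q) {P : Set (Fin d → ℝ)}
    (hP : (interior P).Nonempty) {S : Fin t → Set (Fin d → ℝ)}
    (hS : IsSimplexDecomposition (1 / (q : ℝ)) P S) {n : Fin t → ℕ}
    (hn : ∀ i, sharedVertices S i + n i = polyDim (S i)) :
    normalizedVolume (dual P) ≤ ENNReal.ofReal ((d.factorial * 2 ^ d *
      ∏ i, ∏ k ∈ Finset.Ioc (polyDim (S i) - n i) (polyDim (S i)), u q k : ℕ) / (q : ℝ) ^ d) := by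
  classical
  choose X β hX hXcard hSX hprim hβ hβ1 hβ0 hps using
    fun i => (hS.isLcFanoSimplex i).exists_weights hq
  have hnsum : ∑ i, n i = d := by
    have h1 := hS.sum_dim
    simp_rw [← hn] at h1
    rw [Finset.sum_add_distrib] at h1
    omega
  let J : Fin t → Finset (Fin d → ℝ) := fun i => (X i).filter (· ∉ vert (partialHull S i))
  have hJcard : ∀ i, (J i).card = n i + 1 := by
    intro i
    have h1 : sharedVertices S i = ((X i).filter (· ∈ vert (partialHull S i))).card := by
      rw [sharedVertices, ← Set.ncard_coe_finset, Finset.coe_filter, ← hX]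
      rfl
    have h2 := Finset.card_filter_add_card_filter_not (s := X i) (· ∈ vert (partialHull S i))
    have h3 := hXcard i
    have h4 := hn i
    change ((X i).filter (· ∉ vert (partialHull S i))).card = _
    omega
  -- Each simplex loses one unshared vertex because its vertices satisfy the relation `∑ β v = 0`;
  -- omitting the one of least weight keeps the product large.
  choose w hwJ hw using fun i => exists_pow_le_mul_prod_erase hq (hβ i) (hβ1 i) (hps i)
    (Finset.filter_subset _ (X i) : J i ⊆ X i) (hJcard i)
    (r := sharedVertices S i) (by rw [hXcard, hn i])
  let K : Fin t → Finset (Fin d → ℝ) := fun i => (J i).erase (w i)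
  have hKX : ∀ i, K i ⊆ X i := fun i => (Finset.erase_subset _ _).trans (Finset.filter_subset _ _)
  have hKcard : ∀ i, (K i).card = n i := fun i => by
    rw [Finset.card_erase_of_mem (hwJ i), hJcard i]
    rfl
  have hcard : Fintype.card (Σ i, K i) = d := by
    rw [Fintype.card_sigma]
    exact (Finset.sum_congr rfl fun i _ => by rw [Fintype.card_coe, hKcard]).trans hnsum
  have hXP : ∀ i, (X i : Set (Fin d → ℝ)) ⊆ P := fun i => by
    rw [hS.hull_eq]
    refine Set.Subset.trans ?_ ((Set.subset_iUnion S i).trans (subset_convexHull ℝ _))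
    rw [hSX i]
    exact subset_convexHull ℝ _
  have hspan := span_range_eq_top (K := K) (w := w) hP hS.hull_eq hSX hβ hβ0 fun i v hv hvw => by
      by_cases h : v ∈ vert (partialHull S i)
      · exact Or.inl h.1
      · exact Or.inr (Finset.mem_erase.2 ⟨hvw, Finset.mem_filter.2 ⟨hv, h⟩⟩)
  have hvol : volume (dual P) ≤
      ∏ i, ENNReal.ofReal (((n i).factorial * ∏ v ∈ K i, β i v)⁻¹) := by
    refine (measure_mono (dual_subset_setOf_cornerSimplex hXP hKX hβ hβ1 hβ0)).trans ?_
    refine (volume_setOf_dotProduct_add_one_le hcard (fun k => (k.2 : Fin d → ℝ)) (fun k => by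
      obtain ⟨z, hz, -⟩ := hprim k.1 k.2 (hKX k.1 k.2.2)
      exact ⟨z, hz⟩) hspan _).trans ?_
    refine (volume_forall_cornerSimplex_le (fun i (j : K i) => β i j)
      fun i j => hβ i j (hKX i j.2)).trans (le_of_eq ?_)
    refine Finset.prod_congr rfl fun i _ => ?_
    rw [Fintype.card_coe, hKcard, Finset.prod_coe_sort (K i) (β i)]
  have hpos : ∀ i, 0 < ∏ v ∈ K i, β i v := fun i =>
    Finset.prod_pos fun v hv => hβ i v (hKX i hv)
  rw [← ENNReal.ofReal_prod_of_nonneg (fun i _ => by have := hpos i; positivity)] at hvol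
  rw [normalizedVolume]
  calc (d.factorial : ℝ≥0∞) * volume (dual P)
      ≤ ENNReal.ofReal d.factorial *
        ENNReal.ofReal (∏ i, ((n i).factorial * ∏ v ∈ K i, β i v)⁻¹) := by
        rw [ENNReal.ofReal_natCast]
        gcongr
    _ = ENNReal.ofReal (d.factorial * ∏ i, ((n i).factorial * ∏ v ∈ K i, β i v)⁻¹) :=
        (ENNReal.ofReal_mul (by positivity)).symm
    _ ≤ _ := by
        refine ENNReal.ofReal_le_ofReal ?_
        have h1 : ∏ i, ((n i).factorial * ∏ v ∈ K i, β i v)⁻¹ ≤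
            ∏ i, (2 ^ n i * ((∏ k ∈ Finset.Ioc (polyDim (S i) - n i) (polyDim (S i)), u q k : ℕ) : ℝ) /
              (q : ℝ) ^ n i) := by
          refine Finset.prod_le_prod (fun i _ => by have := hpos i; positivity) fun i _ => ?_
          refine inv_factorial_mul_le hq (hpos i) ?_
          have h2 := hn i
          have h3 := hw i
          rw [h2] at h3
          rwa [show polyDim (S i) - n i = sharedVertices S i by omega]
        rw [Finset.prod_div_distrib, Finset.prod_mul_distrib, Finset.prod_pow_eq_pow_sum,
          Finset.prod_pow_eq_pow_sum, hnsum, ← Nat.cast_prod] at h1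
        calc _ ≤ (d.factorial : ℝ) * (2 ^ d * ((∏ i, ∏ k ∈ Finset.Ioc (polyDim (S i) - n i)
              (polyDim (S i)), u q k : ℕ) : ℝ) / (q : ℝ) ^ d) := by gcongr
          _ = _ := by
            push_cast
            ring

end LcFano

theorem proposition5p2 (d q : ℕ) (hd : 3 ≤ d) (hq : 2 ≤ q)
    (P : Set (Fin d → ℝ)) (hP : LcFano.IsMinimalLcFanoPolytope (1 / (q : ℝ)) P)
    (hsimplex : ¬ LcFano.IsSimplex P)
    (t : ℕ) (S : Fin t → Set (Fin d → ℝ))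
    (hS : LcFano.IsSimplexDecomposition (1 / (q : ℝ)) P S)
    (hexc : ¬ (t = 2 ∧ ∀ i, LcFano.polyDim (S i) = d - 1)) :
    LcFano.normalizedVolume (LcFano.dual P) <
      ENNReal.ofReal (2 * (LcFano.u q d : ℝ) ^ 2 / (q : ℝ) ^ (d + 1)) := by
  choose n hn using fun i => Nat.exists_eq_add_of_le (hS.shared_lt i).le
  have hsum : ∑ i, n i = d := by
    have h1 := hS.sum_dim
    simp_rw [hn] at h1
    rw [Finset.sum_add_distrib] at h1
    omega
  refine (LcFano.normalizedVolume_dual_le (by omega) ⟨0, hP.isLcFano.zero_mem⟩ hS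
    (fun i => (hn i).symm)).trans_lt ?_
  have hnum := LcFano.prod_windows_lt hq hd hS.two_le hS.le_dim n (fun i => LcFano.polyDim (S i))
    (fun i => by have := hS.shared_lt i; have := hn i; omega)
    (fun i => by have := hn i; omega) hsum hS.dim_le
    -- Nothing precedes the first simplex, so it shares no vertex and its window starts at index 1.
    (fun i hi => by
      have := hn i
      rw [LcFano.sharedVertices_eq_zero S hi] at this
      omega) hexc
  have hud : 0 < LcFano.u q d := LcFano.u_pos (by omega) (by omega)
  have hq0 : (0 : ℝ) < q := by positivity
  refine (ENNReal.ofReal_lt_ofReal_iff (by positivity)).2 ?_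
  rw [div_lt_div_iff₀ (by positivity) (by positivity), pow_succ]
  have hnum' := (Nat.cast_lt (α := ℝ)).2 hnum
  push_cast at hnum' ⊢
  calc _ = (d.factorial * 2 ^ d * q * ∏ i, ∏ k ∈ Finset.Ioc (LcFano.polyDim (S i) - n i)
        (LcFano.polyDim (S i)), (LcFano.u q k : ℝ)) * (q : ℝ) ^ d := by ring
    _ < _ := by gcongr
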